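/- Let $\mathbb{K}$ be any field. For $n\ge 0$ let $E=\bigwedge_{\mathbb K}\langle e_1,\dots,e_n\rangle$ be the exterior algebra on $n$ variables, graded by $\deg e_i=1$. For a finite simple graph $G$ on the vertex set $\{1,\dots,n\}$, the exterior edge ideal of $G$ is $I_E(G)=(e_ie_j \mid \{i,j\}\text{ is an edge of }G)\subseteq E$. A linear form $\ell\in E_1$ is regular on an $E$-module $M$ if $\{m\in M\mid \ell m=0\}=\ell M$; a sequence $\ell_1,\dots,\ell_r\in E_1$ is a regular sequence on $M$ if each $\ell_i$ is regular on $M/(\ell_1,\dots,\ell_{i-1})M$. A graded $\mathbb K$-algebra $R$ is G-quadratic if $R\cong E/J$ as graded algebras for some exterior algebra $E$ in finitely many variables and some graded ideal $J\subseteq E$ that has a Gröbner basis consisting of homogeneous elements of degree $2$, with respect to some coordinates on $E_1$ and some monomial order. It is LG-quadratic if $R\cong A/(\ell_1,\dots,\ell_r)$ as graded algebras for some G-quadratic quotient $A$ of an exterior algebra in finitely many variables and some regular sequence of linear forms $\ell_1,\dots,\ell_r$ on $A$. Theorem. Let $E=\bigwedge_{\mathbb K}\langle e_1,\dots,e_7\rangle$,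 let $P_7$ be the path graph with edges $\{i,i+1\}$, $1\le i\le 6$, so that $I_E(P_7)=(e_1e_2,e_2e_3,e_3e_4,e_4e_5,e_5e_6,e_6e_7)$, and let \[R=E/\bigl(I_E(P_7)+(e_1+e_4+e_7)\bigr).\] Then: (1) $e_1+e_4+e_7$ is regular on $E/I_E(P_7)$; (2) $R$ is LG-quadratic; (3) $R$ is not G-quadratic; (4) the Hilbert series of $R$ is $\sum_i \dim_{\mathbb K}(R_i)\,t^i=1+6t+9t^2+t^3$; (5) for every $n\ge 0$ and every simple graph $G$ on $\{1,\dots,n\}$, the Hilbert series of $\bigwedge_{\mathbb K}\langle e_1,\dots,e_n\rangle/I_E(G)$ is different from $1+6t+9t^2+t^3$. -/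

import Mathlib

open scoped PowerSeries

noncomputable section

/-- The exterior algebra `E = ⋀ K⟨e_0, …, e_{n-1}⟩` on `n` variables. -/
abbrev ExtAlg (K : Type*) [Field K] (n : ℕ) : Type _ := ExteriorAlgebra K (Fin n → K)

/-- The component `E_i` of degree `i`. -/
abbrev extDeg (K : Type*) [Field K] (n i : ℕ) : Submodule K (ExtAlg K n) :=
  ExteriorAlgebra.exteriorPower K i (Fin n → K)

/-- The variable `e_i`, as an element of `E_1`. -/
abbrev extVar (K : Type*) [Field K] {n : ℕ} (i : Fin n) : ExtAlg K n :=
  ExteriorAlgebra.ι K (Pi.single i (1 : K) : Fin n → K)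

/-- The quotient algebra `E / I` by a two-sided ideal. -/
abbrev ExtQuot {K : Type*} [Field K] {n : ℕ} (I : TwoSidedIdeal (ExtAlg K n)) : Type _ :=
  ExtAlg K n ⧸ I.asIdeal

/-- The ideal `I` of `E` is graded. -/
def IsGradedIdeal {K : Type*} [Field K] {n : ℕ} (I : TwoSidedIdeal (ExtAlg K n)) : Prop :=
  ∀ f ∈ I, ∀ i : ℕ, (DirectSum.decompose (fun i : ℕ => extDeg K n i) f i : ExtAlg K n) ∈ I

/-- The degree `i` component of `E / I`: the image of `E_i`. -/
def quotDeg {K : Type*} [Field K] {n : ℕ} (I : TwoSidedIdeal (ExtAlg K n)) (i : ℕ) :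
    Submodule K (ExtQuot I) :=
  (extDeg K n i).map (Ideal.Quotient.mkₐ K I.asIdeal).toLinearMap

/-- The Hilbert series `∑ dim_K (R_i) t^i` of an algebra `R` with components `R_i = 𝒜 i`. -/
def hilbertSeries {K R : Type*} [Field K] [Ring R] [Algebra K R]
    (𝒜 : ℕ → Submodule K R) : ℤ⟦X⟧ :=
  PowerSeries.mk fun i => (Module.finrank K (𝒜 i) : ℤ)

/-- Isomorphism of graded `K`-algebras. -/
def GradedIso {K R S : Type*} [Field K] [Ring R] [Algebra K R] [Ring S] [Algebra K S]
    (𝒜 : ℕ → Submodule K R) (ℬ : ℕ → Submodule K S) : Prop :=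
  ∃ φ : R ≃ₐ[K] S, ∀ i : ℕ, (𝒜 i).map φ.toLinearMap = ℬ i

/-- A monomial order on an exterior algebra in `n` variables. The monomial `e_{i_1} ⋯ e_{i_t}`
with `i_1 < ⋯ < i_t` is represented by the set `{i_1, …, i_t}`; a product of two monomials is
nonzero exactly if the sets are disjoint, and then it is, up to sign, the monomial of the union. -/
structure ExtMonomialOrder (n : ℕ) where
  lt : Finset (Fin n) → Finset (Fin n) → Prop
  isStrictTotalOrder : IsStrictTotalOrder (Finset (Fin n)) lt
  empty_lt : ∀ u : Finset (Fin n), u ≠ ∅ → lt ∅ u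
  mul_lt_mul : ∀ u v w : Finset (Fin n), lt u v → Disjoint u w → Disjoint v w →
    lt (u ∪ w) (v ∪ w)

/-- `u` is the leading monomial of `f` in the coordinates `b` of `E_1`. Here
`b.ExteriorAlgebra` is the basis of `E` that consists of the monomials in the `b i`. -/
def IsLeadingMonomial {K : Type*} [Field K] {n : ℕ} (b : Module.Basis (Fin n) K (Fin n → K))
    (o : ExtMonomialOrder n) (f : ExtAlg K n) (u : Finset (Fin n)) : Prop :=
  b.ExteriorAlgebra.repr f u ≠ 0 ∧
    ∀ v : Finset (Fin n), b.ExteriorAlgebra.repr f v ≠ 0 → v ≠ u → o.lt v u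

/-- The ideal generated by the leading monomials of the elements of `S`. -/
def leadingIdeal {K : Type*} [Field K] {n : ℕ} (b : Module.Basis (Fin n) K (Fin n → K))
    (o : ExtMonomialOrder n) (S : Set (ExtAlg K n)) : TwoSidedIdeal (ExtAlg K n) :=
  TwoSidedIdeal.span
    {x | ∃ f ∈ S, ∃ u : Finset (Fin n), IsLeadingMonomial b o f u ∧ x = b.ExteriorAlgebra u}

/-- `G` is a Gröbner basis of `I` in the coordinates `b`. -/
def IsExtGroebnerBasis {K : Type*} [Field K] {n : ℕ} (b : Module.Basis (Fin n) K (Fin n → K))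
    (o : ExtMonomialOrder n) (I : TwoSidedIdeal (ExtAlg K n)) (G : Finset (ExtAlg K n)) : Prop :=
  (∀ g ∈ G, g ∈ I) ∧ leadingIdeal b o (G : Set (ExtAlg K n)) = leadingIdeal b o {f | f ∈ I}

/-- `I` has a Gröbner basis of quadrics, for some coordinates on `E_1` and some monomial order. -/
def HasQuadraticGroebnerBasis {K : Type*} [Field K] {n : ℕ} (I : TwoSidedIdeal (ExtAlg K n)) :
    Prop :=
  ∃ (b : Module.Basis (Fin n) K (Fin n → K)) (o : ExtMonomialOrder n) (G : Finset (ExtAlg K n)),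
    IsExtGroebnerBasis b o I G ∧ ∀ g ∈ G, g ∈ extDeg K n 2

/-- The graded algebra `R` is G-quadratic: it is, up to graded isomorphism, a quotient `E' / J`
of some exterior algebra by a graded ideal `J` that has a Gröbner basis of quadrics. -/
def IsGQuadratic {K R : Type*} [Field K] [Ring R] [Algebra K R] (𝒜 : ℕ → Submodule K R) : Prop :=
  ∃ (n : ℕ) (J : TwoSidedIdeal (ExtAlg K n)),
    IsGradedIdeal J ∧ HasQuadraticGroebnerBasis J ∧ GradedIso 𝒜 (quotDeg J)

/-- `ℓ ∈ E_1` is regular on the `E`-module `M`: `{m | ℓ m = 0} = ℓ M`. -/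
def IsExtRegular {K : Type*} [Field K] {n : ℕ} (l : Fin n → K)
    (M : Type*) [AddCommGroup M] [Module (ExtAlg K n) M] : Prop :=
  {m : M | ExteriorAlgebra.ι K l • m = 0} = Set.range fun m : M => ExteriorAlgebra.ι K l • m

/-- `ℓ_0, …, ℓ_{r-1}` is a regular sequence on `M`: each `ℓ_i` is regular on
`M / (ℓ_0, …, ℓ_{i-1}) M`. -/
def IsExtRegularSequence {K : Type*} [Field K] {n r : ℕ} (l : Fin r → Fin n → K)
    (M : Type*) [AddCommGroup M] [Module (ExtAlg K n) M] : Prop :=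
  ∀ i : Fin r, IsExtRegular (l i)
    (M ⧸ Submodule.span (ExtAlg K n)
      {x : M | ∃ j : Fin r, j < i ∧ ∃ m : M, x = ExteriorAlgebra.ι K (l j) • m})

/-- The ideal of `E` generated by linear forms. -/
def linearIdeal {K : Type*} [Field K] {n r : ℕ} (l : Fin r → Fin n → K) :
    TwoSidedIdeal (ExtAlg K n) :=
  TwoSidedIdeal.span (Set.range fun i : Fin r => ExteriorAlgebra.ι K (l i))

/-- The graded algebra `R` is LG-quadratic: there are a G-quadratic algebra `A = E' / J` and a
regular sequence of linear forms on `A` with `R ≅ A / (ℓ_0, …, ℓ_{r-1})`, that is,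
`R ≅ E' / (J + (ℓ_0, …, ℓ_{r-1}))`. -/
def IsLGQuadratic {K R : Type*} [Field K] [Ring R] [Algebra K R] (𝒜 : ℕ → Submodule K R) : Prop :=
  ∃ (n : ℕ) (J : TwoSidedIdeal (ExtAlg K n)) (r : ℕ) (l : Fin r → Fin n → K),
    IsGradedIdeal J ∧ IsGQuadratic (quotDeg J) ∧ IsExtRegularSequence l (ExtQuot J) ∧
      GradedIso 𝒜 (quotDeg (J ⊔ linearIdeal l))

/-- The exterior edge ideal `I_E(G) = (e_i e_j | {i, j} an edge of G)`. -/
def extEdgeIdeal (K : Type*) [Field K] {n : ℕ} (G : SimpleGraph (Fin n)) :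
    TwoSidedIdeal (ExtAlg K n) :=
  TwoSidedIdeal.span {x | ∃ i j : Fin n, G.Adj i j ∧ x = extVar K i * extVar K j}

/-- The linear form `e_1 + e_4 + e_7` in seven variables (indexed from `0` here). -/
def pathForm (K : Type*) [Field K] : Fin 7 → K :=
  Pi.single 0 1 + Pi.single 3 1 + Pi.single 6 1

/-- The ideal `I_E(P_7) + (e_1 + e_4 + e_7)`. -/
def pathIdeal (K : Type*) [Field K] : TwoSidedIdeal (ExtAlg K 7) :=
  extEdgeIdeal K (SimpleGraph.pathGraph 7) ⊔
    TwoSidedIdeal.span {ExteriorAlgebra.ι K (pathForm K)}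

end

/-!
Everything rests on the comparison of a graded quotient of an exterior algebra with the monomials
that are not leading monomials of its ideal (`finrank_quotDeg_eq_card`, Macaulay's theorem). For an
edge ideal, these monomials are the independent sets of the graph
(`finrank_quotDeg_extEdgeIdeal`). For an arbitrary graded ideal with a quadratic Gröbner basis, the
leading monomials are the multiples of the quadratic ones, so they are again the dependent sets of
a graph (`HasQuadraticGroebnerBasis.exists_graph`). Hence the Hilbert series of a G-quadratic
algebra counts the independent sets of some graph by size.

No graph has independence numbers `1, 6, 9, 1` (`not_indepCount_eq`): in the complement, a graph on
six vertices with a single triangle, each of the three other vertices has at most one neighbour in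
the triangle and the three others span at most two edges, so there are at most
`3 + 3 + 2 = 8` edges.
So `1 + 6t + 9t² + t³` is the Hilbert series neither of a quotient by an edge ideal nor of a
G-quadratic algebra.

The regularity of `ℓ = e₁ + e₄ + e₇` modulo the edge ideal `I` of the path holds because every
independent set `S` leaves one of the vertices `1, 4, 7` without neighbours in `S`, and such a vertex
`freeVertex S` can be chosen to depend only on the other vertices in `S`. Contracting the monomial
of `S` against the coordinate of this vertex gives a linear map `s` of degree `-1` with
`s (ℓ x) + ℓ s x = x` and `s I ⊆ I` (`pathHomotopy_add`, `pathHomotopy_mem`). Thus `ℓ x ∈ I` implies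
`x ∈ I + ℓ E`.

Consequently multiplication by `ℓ` embeds `R = E / (I + (ℓ))` into `A = E / I`, and rank–nullity
gives `dim R_i + dim R_{i-1} = dim A_i`. The dimensions of `A` are `1, 7, 15, 10, 1`, whence those of `R`
are `1, 6, 9, 1`. Finally `R` is LG-quadratic because the monomial ideal `I` has its generators as
Gröbner basis. In the code the variables are numbered from `0`.
-/

/-! ### Monomials and monomial ideals -/

open ExteriorAlgebra Set.powersetCard in
/-- Up to a scalar, the product of two monomials is the monomial of the union; the scalar vanishes
exactly if the two monomials share a variable. -/
theorem exists_monomial_mul {K : Type*} [Field K] {n : ℕ} (b : Module.Basis (Fin n) K (Fin n → K))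
    (u v : Finset (Fin n)) :
    ∃ c : K, b.ExteriorAlgebra u * b.ExteriorAlgebra v = c • b.ExteriorAlgebra (u ∪ v) ∧
      (c ≠ 0 ↔ Disjoint u v) := by
  by_cases h : Disjoint u v
  · have := basis_mul_of_disjoint b (⟨u, rfl⟩ : Set.powersetCard (Fin n) u.card)
      (⟨v, rfl⟩ : Set.powersetCard (Fin n) v.card) h
    refine ⟨((Int.cast ((permOfDisjoint (s := (⟨u, rfl⟩ : Set.powersetCard (Fin n) u.card))
      (t := (⟨v, rfl⟩ : Set.powersetCard (Fin n) v.card)) h).sign : ℤ)) : K), ?_, ?_⟩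
    · have e : (disjUnion (s := (⟨u, rfl⟩ : Set.powersetCard (Fin n) u.card))
        (t := (⟨v, rfl⟩ : Set.powersetCard (Fin n) v.card)) h : Finset (Fin n)) = u ∪ v := by
        simp [disjUnion]
      rw [e] at this
      rw [this, Int.cast_smul_eq_zsmul]
      rfl
    · simp only [h, iff_true]
      rcases Int.units_eq_one_or (permOfDisjoint
        (s := (⟨u, rfl⟩ : Set.powersetCard (Fin n) u.card))
        (t := (⟨v, rfl⟩ : Set.powersetCard (Fin n) v.card)) h).sign with e | e <;> simp [e]
  · refine ⟨0, ?_, by simp [h]⟩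
    rw [zero_smul]
    exact basis_mul_of_not_disjoint b (⟨u, rfl⟩ : Set.powersetCard (Fin n) u.card)
      (⟨v, rfl⟩ : Set.powersetCard (Fin n) v.card) h

theorem monomial_mem_extDeg {K : Type*} [Field K] {n : ℕ}
    (b : Module.Basis (Fin n) K (Fin n → K)) (u : Finset (Fin n)) :
    b.ExteriorAlgebra u ∈ extDeg K n u.card := by
  have := ExteriorAlgebra.basis_eq_coe_basis b (⟨u, rfl⟩ : Set.powersetCard (Fin n) u.card)
  rw [show b.ExteriorAlgebra u = _ from this]
  exact Subtype.property _

theorem monomial_singleton {K : Type*} [Field K] {n : ℕ}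
    (b : Module.Basis (Fin n) K (Fin n → K)) (i : Fin n) :
    b.ExteriorAlgebra {i} = ExteriorAlgebra.ι K (b i) := by
  rw [ExteriorAlgebra.basis_apply_ofCard b (Finset.card_singleton i)]
  simp [ExteriorAlgebra.ιMulti_family, ExteriorAlgebra.ιMulti_apply]
  congr 2
  exact Finset.mem_singleton.1 (Finset.orderEmbOfFin_mem _ _ _)

theorem ι_mul_mem_extDeg {K : Type*} [Field K] {n i : ℕ} (l : Fin n → K) {x : ExtAlg K n}
    (hx : x ∈ extDeg K n i) : ExteriorAlgebra.ι K l * x ∈ extDeg K n (i + 1) := by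
  rw [add_comm]
  refine SetLike.mul_mem_graded (A := fun i : ℕ => extDeg K n i) (i := 1) ?_ hx
  rw [extDeg, ExteriorAlgebra.exteriorPower, pow_one]
  exact ⟨l, rfl⟩

/-- The set of elements supported on an upward closed family of monomials absorbs products. -/
theorem mul_mem_span_monomials {K : Type*} [Field K] {n : ℕ}
    (b : Module.Basis (Fin n) K (Fin n → K)) {T : Set (Finset (Fin n))} (hT : IsUpperSet T)
    {x : ExtAlg K n} (hx : x ∈ Submodule.span K (b.ExteriorAlgebra '' T)) (y : ExtAlg K n) :
    y * x ∈ Submodule.span K (b.ExteriorAlgebra '' T) ∧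
      x * y ∈ Submodule.span K (b.ExteriorAlgebra '' T) := by
  have hy : y ∈ Submodule.span K (Set.range b.ExteriorAlgebra) := by
    rw [b.ExteriorAlgebra.span_eq]; trivial
  have key : ∀ u v, (u ∈ T ∨ v ∈ T) → b.ExteriorAlgebra u * b.ExteriorAlgebra v ∈
      Submodule.span K (b.ExteriorAlgebra '' T) := by
    intro u v h
    obtain ⟨c, hc, -⟩ := exists_monomial_mul b u v
    rw [hc]
    refine Submodule.smul_mem _ _ (Submodule.subset_span ⟨_, ?_, rfl⟩)
    rcases h with h | h
    · exact hT Finset.subset_union_left h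
    · exact hT Finset.subset_union_right h
  constructor
  · have := Submodule.mul_mem_mul hy hx
    rw [Submodule.span_mul_span] at this
    refine Submodule.span_le.2 ?_ this
    rintro _ ⟨_, ⟨u, rfl⟩, _, ⟨v, hv, rfl⟩, rfl⟩
    exact key u v (Or.inr hv)
  · have := Submodule.mul_mem_mul hx hy
    rw [Submodule.span_mul_span] at this
    refine Submodule.span_le.2 ?_ this
    rintro _ ⟨_, ⟨v, hv, rfl⟩, _, ⟨u, rfl⟩, rfl⟩
    exact key v u (Or.inl hv)

theorem mem_span_monomials_iff {K : Type*} [Field K] {n : ℕ}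
    (b : Module.Basis (Fin n) K (Fin n → K)) (T : Set (Finset (Fin n))) (x : ExtAlg K n) :
    x ∈ Submodule.span K (b.ExteriorAlgebra '' T) ↔
      ∀ u, b.ExteriorAlgebra.repr x u ≠ 0 → u ∈ T := by
  rw [Module.Basis.mem_span_image]
  simp [Set.subset_def]

theorem smul_mem_twoSidedIdeal {K : Type*} [Field K] {n : ℕ} (I : TwoSidedIdeal (ExtAlg K n))
    (c : K) {x : ExtAlg K n} (hx : x ∈ I) : c • x ∈ I := by
  rw [Algebra.smul_def]
  exact I.mul_mem_left _ _ hx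

theorem sum_repr_smul_monomial {K : Type*} [Field K] {n : ℕ}
    (b : Module.Basis (Fin n) K (Fin n → K)) (x : ExtAlg K n) :
    ∑ u, b.ExteriorAlgebra.repr x u • b.ExteriorAlgebra u = x :=
  b.ExteriorAlgebra.sum_repr x

/-- An element lies in a monomial ideal exactly if each of its monomials is divisible by one of the
generators. -/
theorem mem_monomialIdeal_iff {K : Type*} [Field K] {n : ℕ}
    (b : Module.Basis (Fin n) K (Fin n → K)) (S : Set (Finset (Fin n))) (x : ExtAlg K n) :
    x ∈ TwoSidedIdeal.span (b.ExteriorAlgebra '' S) ↔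
      ∀ u, b.ExteriorAlgebra.repr x u ≠ 0 → ∃ v ∈ S, v ⊆ u := by
  have hT : IsUpperSet {u : Finset (Fin n) | ∃ v ∈ S, v ⊆ u} :=
    fun u w h ⟨v, hv, hvu⟩ => ⟨v, hv, hvu.trans h⟩
  constructor
  · intro hx
    let M : TwoSidedIdeal (ExtAlg K n) := TwoSidedIdeal.mk'
      (Submodule.span K (b.ExteriorAlgebra '' {u | ∃ v ∈ S, v ⊆ u}))
      (Submodule.zero_mem _) (Submodule.add_mem _) (Submodule.neg_mem _)
      (fun {y x} hx => (mul_mem_span_monomials b hT hx y).1)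
      (fun {x y} hx => (mul_mem_span_monomials b hT hx y).2)
    have hM : TwoSidedIdeal.span (b.ExteriorAlgebra '' S) ≤ M := by
      rw [TwoSidedIdeal.span_le]
      rintro _ ⟨u, hu, rfl⟩
      rw [SetLike.mem_coe, TwoSidedIdeal.mem_mk']
      exact Submodule.subset_span ⟨u, ⟨u, hu, subset_rfl⟩, rfl⟩
    have := hM hx
    rw [TwoSidedIdeal.mem_mk'] at this
    exact (mem_span_monomials_iff b _ x).1 this
  · intro h
    rw [← sum_repr_smul_monomial b x]
    refine sum_mem fun u _ => ?_
    by_cases h0 : b.ExteriorAlgebra.repr x u = 0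
    · rw [h0, zero_smul]; exact TwoSidedIdeal.zero_mem _
    obtain ⟨v, hv, hvu⟩ := h u h0
    obtain ⟨c, hc, hd⟩ := exists_monomial_mul b (u \ v) v
    have hc0 : c ≠ 0 := hd.2 Finset.sdiff_disjoint
    rw [Finset.sdiff_union_of_subset hvu] at hc
    have : b.ExteriorAlgebra u = c⁻¹ • (b.ExteriorAlgebra (u \ v) * b.ExteriorAlgebra v) := by
      rw [hc, smul_smul, inv_mul_cancel₀ hc0, one_smul]
    rw [this]
    exact smul_mem_twoSidedIdeal _ _ (smul_mem_twoSidedIdeal _ _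
      (TwoSidedIdeal.mul_mem_left _ _ _ (TwoSidedIdeal.subset_span ⟨v, hv, rfl⟩)))

/-- The monomials of the component of degree `i` of `x` are those monomials of `x` that have
degree `i`. -/
theorem repr_decompose {K : Type*} [Field K] {n : ℕ}
    (b : Module.Basis (Fin n) K (Fin n → K)) (x : ExtAlg K n) (i : ℕ) (u : Finset (Fin n)) :
    b.ExteriorAlgebra.repr (DirectSum.decompose (fun i : ℕ => extDeg K n i) x i : ExtAlg K n) u =
      if u.card = i then b.ExteriorAlgebra.repr x u else 0 := by
  have hx : x ∈ Submodule.span K (Set.range b.ExteriorAlgebra) := by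
    rw [b.ExteriorAlgebra.span_eq]; trivial
  induction hx using Submodule.span_induction with
  | mem x h =>
    obtain ⟨v, rfl⟩ := h
    by_cases hv : v.card = i
    · subst hv
      rw [DirectSum.decompose_of_mem_same _ (monomial_mem_extDeg b v)]
      split_ifs with h
      · rfl
      · rw [Module.Basis.repr_self, Finsupp.single_eq_of_ne (fun e => h (by rw [e]))]
    · rw [DirectSum.decompose_of_mem_ne _ (monomial_mem_extDeg b v) hv]
      split_ifs with h
      · rw [Module.Basis.repr_self, Finsupp.single_eq_of_ne (fun e => hv (by rw [← e, h]))]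
        simp
      · simp
  | zero => simp
  | add x y _ _ hx hy =>
    rw [DirectSum.decompose_add, DirectSum.add_apply, Submodule.coe_add, map_add,
      Finsupp.add_apply, hx, hy, map_add]
    split_ifs <;> simp
  | smul c x _ hx =>
    rw [DirectSum.decompose_smul, DirectSum.smul_apply, Submodule.coe_smul, map_smul,
      Finsupp.smul_apply, hx, map_smul]
    split_ifs <;> simp

theorem mem_extDeg_iff {K : Type*} [Field K] {n : ℕ}
    (b : Module.Basis (Fin n) K (Fin n → K)) (x : ExtAlg K n) (i : ℕ) :
    x ∈ extDeg K n i ↔ ∀ u, b.ExteriorAlgebra.repr x u ≠ 0 → u.card = i := by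
  constructor
  · intro hx u hu
    rw [← DirectSum.decompose_of_mem_same (fun i : ℕ => extDeg K n i) hx, repr_decompose] at hu
    by_contra h
    exact hu (if_neg h)
  · intro h
    rw [← sum_repr_smul_monomial b x]
    refine Submodule.sum_mem _ fun u _ => ?_
    by_cases h0 : b.ExteriorAlgebra.repr x u = 0
    · rw [h0, zero_smul]; exact Submodule.zero_mem _
    · exact Submodule.smul_mem _ _ (h u h0 ▸ monomial_mem_extDeg b u)

/-! ### Leading monomials and Macaulay's theorem -/

/-- The leading monomials of the elements of `S`, as index sets. -/
def leadingMonomials {K : Type*} [Field K] {n : ℕ} (b : Module.Basis (Fin n) K (Fin n → K))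
    (o : ExtMonomialOrder n) (S : Set (ExtAlg K n)) : Set (Finset (Fin n)) :=
  {u | ∃ f ∈ S, IsLeadingMonomial b o f u}

theorem leadingIdeal_eq_span {K : Type*} [Field K] {n : ℕ}
    (b : Module.Basis (Fin n) K (Fin n → K)) (o : ExtMonomialOrder n) (S : Set (ExtAlg K n)) :
    leadingIdeal b o S = TwoSidedIdeal.span (b.ExteriorAlgebra '' leadingMonomials b o S) := by
  unfold leadingIdeal leadingMonomials
  congr 1
  ext x
  constructor
  · rintro ⟨f, hf, u, hu, rfl⟩
    exact ⟨u, ⟨f, hf, hu⟩, rfl⟩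
  · rintro ⟨u, ⟨f, hf, hu⟩, rfl⟩
    exact ⟨f, hf, u, hu, rfl⟩

theorem monomial_mem_leadingIdeal_iff {K : Type*} [Field K] {n : ℕ}
    (b : Module.Basis (Fin n) K (Fin n → K)) (o : ExtMonomialOrder n) (S : Set (ExtAlg K n))
    (u : Finset (Fin n)) :
    b.ExteriorAlgebra u ∈ leadingIdeal b o S ↔ ∃ v ∈ leadingMonomials b o S, v ⊆ u := by
  rw [leadingIdeal_eq_span, mem_monomialIdeal_iff]
  constructor
  · exact fun h => h u (by simp)
  · intro h w hw
    rw [Module.Basis.repr_self] at hw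
    rwa [(Finsupp.single_apply_ne_zero.1 hw).1]

theorem exists_isLeadingMonomial {K : Type*} [Field K] {n : ℕ}
    (b : Module.Basis (Fin n) K (Fin n → K)) (o : ExtMonomialOrder n) {f : ExtAlg K n}
    (hf : f ≠ 0) : ∃ u, IsLeadingMonomial b o f u := by
  have := o.isStrictTotalOrder
  have wf : WellFounded (Function.swap o.lt) := Finite.wellFounded_of_trans_of_irrefl _
  have hne : {u | b.ExteriorAlgebra.repr f u ≠ 0}.Nonempty := by
    by_contra h
    rw [Set.not_nonempty_iff_eq_empty, Set.eq_empty_iff_forall_notMem] at h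
    refine hf ((LinearEquiv.map_eq_zero_iff b.ExteriorAlgebra.repr).1 (Finsupp.ext fun u => ?_))
    simpa using h u
  obtain ⟨u, hu, hmin⟩ := wf.has_min _ hne
  refine ⟨u, hu, fun v hv hvu => ?_⟩
  rcases trichotomous_of o.lt v u with h | h | h
  · exact h
  · exact absurd h hvu
  · exact absurd h (hmin v hv)

/-- Multiplying `f` by the monomial `w \ u` turns the leading monomial `u` of `f` into `w`. -/
theorem isUpperSet_leadingMonomials {K : Type*} [Field K] {n : ℕ}
    (b : Module.Basis (Fin n) K (Fin n → K)) (o : ExtMonomialOrder n)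
    (I : TwoSidedIdeal (ExtAlg K n)) : IsUpperSet (leadingMonomials b o {f | f ∈ I}) := by
  rintro u w huw ⟨f, hf, hu, hlt⟩
  refine ⟨b.ExteriorAlgebra (w \ u) * f, I.mul_mem_left _ _ hf, ?_⟩
  choose c hc hd using fun v => exists_monomial_mul b (w \ u) v
  have hexp : ∀ x, b.ExteriorAlgebra.repr (b.ExteriorAlgebra (w \ u) * f) x =
      ∑ v, b.ExteriorAlgebra.repr f v * c v * if w \ u ∪ v = x then 1 else 0 := by
    intro x
    conv_lhs => rw [← sum_repr_smul_monomial b f]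
    simp only [Finset.mul_sum, mul_smul_comm, hc, map_sum, map_smul, Finsupp.coe_finsetSum,
      Finset.sum_apply, Finsupp.smul_apply, Module.Basis.repr_self, smul_eq_mul,
      Finsupp.single_apply, mul_assoc]
  have huw' : w \ u ∪ u = w := Finset.sdiff_union_of_subset huw
  constructor
  · rw [hexp, Finset.sum_eq_single u]
    · rw [if_pos huw', mul_one]
      exact mul_ne_zero hu ((hd u).2 Finset.sdiff_disjoint)
    · intro v _ hvu
      by_cases hcv : c v = 0
      · simp [hcv]
      have hdis := (hd v).1 hcv
      rw [if_neg, mul_zero]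
      intro h
      apply hvu
      rw [← Finset.union_sdiff_cancel_left hdis, h, Finset.sdiff_sdiff_eq_self huw]
    · simp
  · intro x hx hxw
    rw [hexp] at hx
    obtain ⟨v, -, hv⟩ := Finset.exists_ne_zero_of_sum_ne_zero hx
    have hvx : w \ u ∪ v = x := by
      by_contra h
      simp [h] at hv
    have hfv : b.ExteriorAlgebra.repr f v ≠ 0 := fun h => by simp [h] at hv
    have hdis : Disjoint (w \ u) v := (hd v).1 fun h => by simp [h] at hv
    have hvu : v ≠ u := by
      rintro rfl
      exact hxw (by rw [← hvx, huw'])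
    have := o.mul_lt_mul v u (w \ u) (hlt v hfv hvu) hdis.symm Finset.sdiff_disjoint.symm
    rwa [Finset.union_comm v, Finset.union_comm u, hvx, huw'] at this

theorem monomial_mem_leadingIdeal_iff_of_ideal {K : Type*} [Field K] {n : ℕ}
    (b : Module.Basis (Fin n) K (Fin n → K)) (o : ExtMonomialOrder n)
    (I : TwoSidedIdeal (ExtAlg K n)) (u : Finset (Fin n)) :
    b.ExteriorAlgebra u ∈ leadingIdeal b o {f | f ∈ I} ↔
      u ∈ leadingMonomials b o {f | f ∈ I} := by
  rw [monomial_mem_leadingIdeal_iff]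
  exact ⟨fun ⟨v, hv, hvu⟩ => isUpperSet_leadingMonomials b o I hvu hv,
    fun h => ⟨u, h, subset_rfl⟩⟩

theorem mk_eq_zero_iff {K : Type*} [Field K] {n : ℕ} (I : TwoSidedIdeal (ExtAlg K n))
    (x : ExtAlg K n) : Ideal.Quotient.mkₐ K I.asIdeal x = 0 ↔ x ∈ I := by
  rw [Ideal.Quotient.mkₐ_eq_mk, Ideal.Quotient.eq_zero_iff_mem, TwoSidedIdeal.mem_asIdeal]

/-- Modulo `I`, every monomial of degree `i` is a combination of monomials of degree `i` that are
not leading monomials of `I`: one reduces with the degree `i` component of an element of `I`. -/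
theorem mk_monomial_mem_span_standard {K : Type*} [Field K] {n : ℕ}
    (b : Module.Basis (Fin n) K (Fin n → K)) (o : ExtMonomialOrder n)
    {I : TwoSidedIdeal (ExtAlg K n)} (hI : IsGradedIdeal I) (i : ℕ) (u : Finset (Fin n))
    (hu : u.card = i) :
    Ideal.Quotient.mkₐ K I.asIdeal (b.ExteriorAlgebra u) ∈
      Submodule.span K ((fun u => Ideal.Quotient.mkₐ K I.asIdeal (b.ExteriorAlgebra u)) ''
        {u | u.card = i ∧ u ∉ leadingMonomials b o {f | f ∈ I}}) := by
  have := o.isStrictTotalOrder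
  have wf : WellFounded o.lt := Finite.wellFounded_of_trans_of_irrefl _
  induction u using wf.induction with
  | _ u ih =>
    by_cases hlm : u ∈ leadingMonomials b o {f | f ∈ I}
    · obtain ⟨f, hf, hfu, hlt⟩ := hlm
      set g : ExtAlg K n := (DirectSum.decompose (fun i : ℕ => extDeg K n i) f i : ExtAlg K n)
      have hgI : g ∈ I := hI f hf i
      have hg0 := (mk_eq_zero_iff I g).2 hgI
      have hgu : b.ExteriorAlgebra.repr g u = b.ExteriorAlgebra.repr f u := by
        rw [repr_decompose, if_pos hu]
      rw [← sum_repr_smul_monomial b g, map_sum,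
        ← Finset.add_sum_erase _ _ (Finset.mem_univ u), map_smul, hgu,
        add_eq_zero_iff_eq_neg] at hg0
      rw [← one_smul K (Ideal.Quotient.mkₐ K I.asIdeal (b.ExteriorAlgebra u)),
        ← inv_mul_cancel₀ hfu, ← smul_smul, hg0]
      refine Submodule.smul_mem _ _ (Submodule.neg_mem _ (Submodule.sum_mem _ fun v hv => ?_))
      rw [map_smul]
      by_cases hgv : b.ExteriorAlgebra.repr g v = 0
      · rw [hgv, zero_smul]; exact Submodule.zero_mem _
      rw [repr_decompose] at hgv
      have hvi : v.card = i := by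
        by_contra h
        exact hgv (if_neg h)
      rw [if_pos hvi] at hgv
      exact Submodule.smul_mem _ _ (ih v (hlt v hgv (Finset.ne_of_mem_erase hv)) hvi)
    · exact Submodule.subset_span ⟨u, ⟨hu, hlm⟩, rfl⟩

open Classical in
/-- Macaulay's theorem: the monomials of degree `i` that are not leading monomials of a graded
ideal `I` form a basis of `(E / I)_i`. -/
theorem finrank_quotDeg_eq_card {K : Type*} [Field K] {n : ℕ}
    (b : Module.Basis (Fin n) K (Fin n → K)) (o : ExtMonomialOrder n)
    {I : TwoSidedIdeal (ExtAlg K n)} (hI : IsGradedIdeal I) (i : ℕ) :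
    Module.finrank K (quotDeg I i) = (Finset.univ.filter fun u : Finset (Fin n) =>
      u.card = i ∧ u ∉ leadingMonomials b o {f | f ∈ I}).card := by
  have hspan : quotDeg I i =
      Submodule.span K ((fun u => Ideal.Quotient.mkₐ K I.asIdeal (b.ExteriorAlgebra u)) ''
        {u | u.card = i ∧ u ∉ leadingMonomials b o {f | f ∈ I}}) := by
    apply le_antisymm
    · rintro _ ⟨x, hx, rfl⟩
      rw [AlgHom.toLinearMap_apply, ← sum_repr_smul_monomial b x, map_sum]
      refine Submodule.sum_mem _ fun u _ => ?_
      rw [map_smul]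
      by_cases h0 : b.ExteriorAlgebra.repr x u = 0
      · rw [h0, zero_smul]; exact Submodule.zero_mem _
      · exact Submodule.smul_mem _ _ (mk_monomial_mem_span_standard b o hI i u
          ((mem_extDeg_iff b x i).1 hx u h0))
    · rw [Submodule.span_le]
      rintro _ ⟨u, ⟨hu, -⟩, rfl⟩
      exact ⟨b.ExteriorAlgebra u, hu ▸ monomial_mem_extDeg b u, rfl⟩
  let s := Finset.univ.filter fun u : Finset (Fin n) =>
      u.card = i ∧ u ∉ leadingMonomials b o {f | f ∈ I}
  have hli : LinearIndependent K
      (fun u : s => Ideal.Quotient.mkₐ K I.asIdeal (b.ExteriorAlgebra u)) := by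
    rw [Fintype.linearIndependent_iff]
    intro c hc
    by_contra hcon
    push Not at hcon
    obtain ⟨a, ha⟩ := hcon
    -- A nontrivial relation gives a nonzero `f ∈ I` all of whose monomials are non-leading in `I`.
    set f : ExtAlg K n := ∑ u : s, c u • b.ExteriorAlgebra u with hfdef
    have hf : f ∈ I := by
      rw [← mk_eq_zero_iff, hfdef, map_sum]
      simpa only [map_smul] using hc
    have hrepr : ∀ v, b.ExteriorAlgebra.repr f v = ∑ u : s, c u * if u.1 = v then 1 else 0 := by
      intro v
      simp only [hfdef, map_sum, map_smul, Finsupp.coe_finsetSum, Finset.sum_apply,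
        Finsupp.smul_apply, Module.Basis.repr_self, smul_eq_mul, Finsupp.single_apply]
    have hfa : b.ExteriorAlgebra.repr f a = c a := by
      rw [hrepr, Finset.sum_eq_single a]
      · simp
      · intro v _ hv
        rw [if_neg (fun h => hv (Subtype.ext h)), mul_zero]
      · simp
    have hf0 : f ≠ 0 := by
      intro h
      rw [h] at hfa
      exact ha (by simpa using hfa.symm)
    obtain ⟨w, hw⟩ := exists_isLeadingMonomial b o hf0
    have hw0 := hw.1
    rw [hrepr] at hw0
    obtain ⟨u, -, hu⟩ := Finset.exists_ne_zero_of_sum_ne_zero hw0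
    have huw : u.1 = w := by
      by_contra h
      simp [h] at hu
    exact (Finset.mem_filter.1 u.2).2.2 ⟨f, hf, huw ▸ hw⟩
  have hrange : (fun u => Ideal.Quotient.mkₐ K I.asIdeal (b.ExteriorAlgebra u)) ''
        {u | u.card = i ∧ u ∉ leadingMonomials b o {f | f ∈ I}} =
      Set.range (fun u : s => Ideal.Quotient.mkₐ K I.asIdeal (b.ExteriorAlgebra u)) := by
    ext x
    constructor
    · rintro ⟨u, hu, rfl⟩
      exact ⟨⟨u, Finset.mem_filter.2 ⟨Finset.mem_univ _, hu⟩⟩, rfl⟩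
    · rintro ⟨u, rfl⟩
      exact ⟨u, (Finset.mem_filter.1 u.2).2, rfl⟩
  rw [hspan, hrange, finrank_span_eq_card hli, Fintype.card_coe]

/-! ### The colexicographic order -/

/-- The colexicographic order, as a monomial order. -/
def colexMonomialOrder (n : ℕ) : ExtMonomialOrder n where
  lt u v := toColex u < toColex v
  isStrictTotalOrder :=
    { trichotomous := fun u v h1 h2 => by
        rcases lt_trichotomy (toColex u) (toColex v) with h | h | h
        · exact absurd h h1
        · exact toColex_inj.1 h
        · exact absurd h h2
      irrefl := fun u => lt_irrefl _
      trans := fun u v w h1 h2 => lt_trans h1 h2 }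
  empty_lt u hu := by
    rw [Finset.Colex.toColex_empty, bot_lt_iff_ne_bot]
    exact fun h => hu (toColex_inj.1 h)
  mul_lt_mul u v w huv hu hv := by
    rw [← Finset.Colex.toColex_sdiff_lt_toColex_sdiff (u := w) Finset.subset_union_right
      Finset.subset_union_right, Finset.union_sdiff_right, Finset.union_sdiff_right,
      Finset.sdiff_eq_self_of_disjoint hu, Finset.sdiff_eq_self_of_disjoint hv]
    exact huv

/-! ### Edge ideals -/

/-- The basis of monomials in the variables `e_i`. -/
noncomputable abbrev stdMonomial (K : Type*) [Field K] (n : ℕ) :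
    Module.Basis (Finset (Fin n)) K (ExtAlg K n) :=
  (Pi.basisFun K (Fin n)).ExteriorAlgebra

theorem exists_extVar_mul_extVar (K : Type*) [Field K] {n : ℕ} {i j : Fin n} (hij : i ≠ j) :
    ∃ c : K, c ≠ 0 ∧ extVar K i * extVar K j = c • stdMonomial K n {i, j} := by
  obtain ⟨c, hc, hd⟩ := exists_monomial_mul (Pi.basisFun K (Fin n)) {i} {j}
  refine ⟨c, hd.2 (by simpa using hij), ?_⟩
  rw [monomial_singleton, monomial_singleton, Pi.basisFun_apply, Pi.basisFun_apply] at hc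
  exact hc

theorem extEdgeIdeal_eq_span (K : Type*) [Field K] {n : ℕ} (G : SimpleGraph (Fin n)) :
    extEdgeIdeal K G =
      TwoSidedIdeal.span (stdMonomial K n '' {u | ∃ i j, G.Adj i j ∧ u = {i, j}}) := by
  apply le_antisymm
  · rw [extEdgeIdeal, TwoSidedIdeal.span_le]
    rintro _ ⟨i, j, hij, rfl⟩
    obtain ⟨c, -, hc⟩ := exists_extVar_mul_extVar K hij.ne
    rw [hc]
    exact smul_mem_twoSidedIdeal _ _ (TwoSidedIdeal.subset_span ⟨_, ⟨i, j, hij, rfl⟩, rfl⟩)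
  · rw [TwoSidedIdeal.span_le]
    rintro _ ⟨_, ⟨i, j, hij, rfl⟩, rfl⟩
    obtain ⟨c, hc0, hc⟩ := exists_extVar_mul_extVar K hij.ne
    have : stdMonomial K n {i, j} = c⁻¹ • (extVar K i * extVar K j) := by
      rw [hc, smul_smul, inv_mul_cancel₀ hc0, one_smul]
    rw [this]
    exact smul_mem_twoSidedIdeal _ _ (TwoSidedIdeal.subset_span ⟨i, j, hij, rfl⟩)

theorem not_isIndepSet_iff_exists_pair {V : Type*} [DecidableEq V] (G : SimpleGraph V)
    (u : Finset V) :
    ¬ G.IsIndepSet (u : Set V) ↔ ∃ i j, G.Adj i j ∧ ({i, j} : Finset V) ⊆ u := by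
  constructor
  · intro h
    by_contra hcon
    push Not at hcon
    refine h fun i hi j hj _ hadj => hcon i j hadj ?_
    rw [Finset.insert_subset_iff, Finset.singleton_subset_iff]
    exact ⟨hi, hj⟩
  · rintro ⟨i, j, hadj, hsub⟩ h
    rw [Finset.insert_subset_iff, Finset.singleton_subset_iff] at hsub
    exact h hsub.1 hsub.2 hadj.ne hadj

theorem mem_extEdgeIdeal_iff {K : Type*} [Field K] {n : ℕ} (G : SimpleGraph (Fin n))
    (x : ExtAlg K n) :
    x ∈ extEdgeIdeal K G ↔
      ∀ u, (stdMonomial K n).repr x u ≠ 0 → ¬ G.IsIndepSet (u : Set (Fin n)) := by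
  rw [extEdgeIdeal_eq_span, mem_monomialIdeal_iff]
  simp only [not_isIndepSet_iff_exists_pair]
  refine forall_congr' fun u => imp_congr_right fun _ => ?_
  constructor
  · rintro ⟨_, ⟨i, j, h, rfl⟩, hs⟩
    exact ⟨i, j, h, hs⟩
  · rintro ⟨i, j, h, hs⟩
    exact ⟨_, ⟨i, j, h, rfl⟩, hs⟩

theorem isGradedIdeal_extEdgeIdeal (K : Type*) [Field K] {n : ℕ} (G : SimpleGraph (Fin n)) :
    IsGradedIdeal (extEdgeIdeal K G) := by
  intro f hf i
  rw [mem_extEdgeIdeal_iff] at hf ⊢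
  intro u hu
  rw [repr_decompose] at hu
  by_cases h : u.card = i
  · rw [if_pos h] at hu
    exact hf u hu
  · exact absurd (if_neg h) hu

theorem isLeadingMonomial_smul_monomial {K : Type*} [Field K] {n : ℕ}
    (b : Module.Basis (Fin n) K (Fin n → K)) (o : ExtMonomialOrder n) {c : K} (hc : c ≠ 0)
    (u : Finset (Fin n)) : IsLeadingMonomial b o (c • b.ExteriorAlgebra u) u := by
  constructor
  · simpa using hc
  · intro v hv hvu
    rw [map_smul, Module.Basis.repr_self, Finsupp.smul_apply, Finsupp.single_eq_of_ne hvu] at hv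
    simp at hv

theorem mem_leadingMonomials_extEdgeIdeal_iff {K : Type*} [Field K] {n : ℕ}
    (G : SimpleGraph (Fin n)) (o : ExtMonomialOrder n) (u : Finset (Fin n)) :
    u ∈ leadingMonomials (Pi.basisFun K (Fin n)) o {f | f ∈ extEdgeIdeal K G} ↔
      ¬ G.IsIndepSet (u : Set (Fin n)) := by
  constructor
  · rintro ⟨f, hf, hu⟩
    exact (mem_extEdgeIdeal_iff G f).1 hf u hu.1
  · intro h
    refine ⟨stdMonomial K n u, (mem_extEdgeIdeal_iff G _).2 fun v hv => ?_, ?_⟩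
    · rw [Module.Basis.repr_self] at hv
      rwa [(Finsupp.single_apply_ne_zero.1 hv).1]
    · simpa using isLeadingMonomial_smul_monomial (Pi.basisFun K (Fin n)) o one_ne_zero u

open Classical in
/-- The number of independent sets of `i` vertices. -/
noncomputable def indepCount {n : ℕ} (G : SimpleGraph (Fin n)) (i : ℕ) : ℕ :=
  (Finset.univ.filter fun u : Finset (Fin n) => u.card = i ∧ G.IsIndepSet (u : Set (Fin n))).card

theorem finrank_quotDeg_of_leadingMonomials {K : Type*} [Field K] {n : ℕ}
    {b : Module.Basis (Fin n) K (Fin n → K)} {o : ExtMonomialOrder n}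
    {I : TwoSidedIdeal (ExtAlg K n)} (hI : IsGradedIdeal I) {G : SimpleGraph (Fin n)}
    (hG : ∀ u : Finset (Fin n), u ∈ leadingMonomials b o {f | f ∈ I} ↔
      ¬ G.IsIndepSet (u : Set (Fin n))) (i : ℕ) :
    Module.finrank K (quotDeg I i) = indepCount G i := by
  rw [finrank_quotDeg_eq_card b o hI i, indepCount]
  congr 1
  ext u
  simp only [Finset.mem_filter, hG, not_not]

theorem finrank_quotDeg_extEdgeIdeal (K : Type*) [Field K] {n : ℕ} (G : SimpleGraph (Fin n))
    (i : ℕ) : Module.finrank K (quotDeg (extEdgeIdeal K G) i) = indepCount G i :=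
  finrank_quotDeg_of_leadingMonomials (isGradedIdeal_extEdgeIdeal K G)
    (mem_leadingMonomials_extEdgeIdeal_iff G (colexMonomialOrder n)) i

theorem hasQuadraticGroebnerBasis_extEdgeIdeal (K : Type*) [Field K] {n : ℕ}
    (G : SimpleGraph (Fin n)) : HasQuadraticGroebnerBasis (extEdgeIdeal K G) := by
  classical
  refine ⟨Pi.basisFun K (Fin n), colexMonomialOrder n,
    (Finset.univ.filter fun p : Fin n × Fin n => G.Adj p.1 p.2).image
      fun p => extVar K p.1 * extVar K p.2, ⟨?_, ?_⟩, ?_⟩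
  · intro g hg
    obtain ⟨⟨i, j⟩, hp, rfl⟩ := Finset.mem_image.1 hg
    exact TwoSidedIdeal.subset_span ⟨i, j, (Finset.mem_filter.1 hp).2, rfl⟩
  · apply le_antisymm
    · rw [leadingIdeal, TwoSidedIdeal.span_le]
      rintro _ ⟨f, hf, u, hu, rfl⟩
      obtain ⟨⟨i, j⟩, hp, rfl⟩ := Finset.mem_image.1 hf
      exact TwoSidedIdeal.subset_span ⟨extVar K i * extVar K j,
        TwoSidedIdeal.subset_span ⟨i, j, (Finset.mem_filter.1 hp).2, rfl⟩, u, hu, rfl⟩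
    · rw [leadingIdeal_eq_span _ _ {f | f ∈ extEdgeIdeal K G}, TwoSidedIdeal.span_le]
      rintro _ ⟨u, hu, rfl⟩
      rw [mem_leadingMonomials_extEdgeIdeal_iff, not_isIndepSet_iff_exists_pair] at hu
      obtain ⟨i, j, hij, hsub⟩ := hu
      rw [SetLike.mem_coe, monomial_mem_leadingIdeal_iff]
      refine ⟨{i, j}, ⟨extVar K i * extVar K j, ?_, ?_⟩, hsub⟩
      · exact Finset.mem_coe.2 (Finset.mem_image.2
          ⟨(i, j), Finset.mem_filter.2 ⟨Finset.mem_univ _, hij⟩, rfl⟩)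
      · obtain ⟨c, hc0, hc⟩ := exists_extVar_mul_extVar K hij.ne
        rw [hc]
        exact isLeadingMonomial_smul_monomial _ _ hc0 _
  · intro g hg
    obtain ⟨⟨i, j⟩, hp, rfl⟩ := Finset.mem_image.1 hg
    obtain ⟨c, hc0, hc⟩ := exists_extVar_mul_extVar K (Finset.mem_filter.1 hp).2.ne
    rw [hc, ← Finset.card_pair (Finset.mem_filter.1 hp).2.ne]
    exact Submodule.smul_mem _ _ (monomial_mem_extDeg _ _)

/-- If the graded ideal `I` has a quadratic Gröbner basis, its initial ideal is the edge ideal of a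
graph, and `E / I` has the same Hilbert series as the quotient by that edge ideal. -/
theorem HasQuadraticGroebnerBasis.exists_graph {K : Type*} [Field K] {n : ℕ}
    {I : TwoSidedIdeal (ExtAlg K n)} (h : HasQuadraticGroebnerBasis I) (hI : IsGradedIdeal I) :
    ∃ G : SimpleGraph (Fin n), ∀ i, Module.finrank K (quotDeg I i) = indepCount G i := by
  obtain ⟨b, o, S, ⟨-, hS⟩, hquad⟩ := h
  let G : SimpleGraph (Fin n) :=
    { Adj := fun i j => i ≠ j ∧ ({i, j} : Finset (Fin n)) ∈ leadingMonomials b o {f | f ∈ I}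
      symm := ⟨fun i j ⟨hij, h⟩ => ⟨hij.symm, by rwa [Finset.pair_comm]⟩⟩
      loopless := ⟨fun i h => h.1 rfl⟩ }
  refine ⟨G, finrank_quotDeg_of_leadingMonomials hI (b := b) (o := o) fun u => ?_⟩
  rw [not_isIndepSet_iff_exists_pair]
  constructor
  · intro hu
    rw [← monomial_mem_leadingIdeal_iff_of_ideal, ← hS, monomial_mem_leadingIdeal_iff] at hu
    obtain ⟨v, ⟨g, hg, hgv⟩, hvu⟩ := hu
    obtain ⟨i, j, hij, rfl⟩ :=
      Finset.card_eq_two.1 ((mem_extDeg_iff b g 2).1 (hquad g hg) v hgv.1)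
    refine ⟨i, j, ⟨hij, ?_⟩, hvu⟩
    rw [← monomial_mem_leadingIdeal_iff_of_ideal, ← hS, monomial_mem_leadingIdeal_iff]
    exact ⟨_, ⟨g, hg, hgv⟩, subset_rfl⟩
  · rintro ⟨i, j, hij, hsub⟩
    exact isUpperSet_leadingMonomials b o I hsub hij.2

/-! ### Independence numbers -/

theorem indepCount_one {n : ℕ} (G : SimpleGraph (Fin n)) : indepCount G 1 = n := by
  classical
  have : (Finset.univ.filter fun u : Finset (Fin n) => u.card = 1 ∧
      G.IsIndepSet (u : Set (Fin n))) = Finset.powersetCard 1 Finset.univ := by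
    ext u
    simp only [Finset.mem_filter, Finset.mem_univ, true_and, Finset.mem_powersetCard,
      Finset.subset_univ, and_iff_left_iff_imp]
    intro h
    obtain ⟨a, rfl⟩ := Finset.card_eq_one.1 h
    simp [SimpleGraph.IsIndepSet]
  rw [indepCount]
  convert congrArg Finset.card this
  simp

/-- A graph on six vertices with exactly one independent triple `t` has at most eight independent
pairs: three inside `t`, at most two outside `t`, and, for each of the three vertices outside `t`,
at most one joining it to `t`. -/
theorem indepCount_two_le {G : SimpleGraph (Fin 6)} (h : indepCount G 3 = 1) :
    indepCount G 2 ≤ 8 := by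
  classical
  obtain ⟨t, ht⟩ := Finset.card_eq_one.1 h
  have hmem : ∀ u : Finset (Fin 6), u.card = 3 → G.IsIndepSet (u : Set (Fin 6)) → u = t := by
    intro u h1 h2
    rw [← Finset.mem_singleton, ← ht]
    exact Finset.mem_filter.2 ⟨Finset.mem_univ _, h1, h2⟩
  have htt := Finset.mem_filter.1 (ht ▸ Finset.mem_singleton_self t)
  have ht3 : t.card = 3 := htt.2.1
  have htc : tᶜ.card = 3 := by rw [Finset.card_compl, ht3]; rfl
  let P := Finset.univ.filter fun u : Finset (Fin 6) =>
    u.card = 2 ∧ G.IsIndepSet (u : Set (Fin 6))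
  have hP : ∀ p ∈ P, p.card = 2 ∧ G.IsIndepSet (p : Set (Fin 6)) :=
    fun p hp => (Finset.mem_filter.1 hp).2
  have hsum : ∀ p : Finset (Fin 6), (p ∩ t).card + (p \ t).card = p.card :=
    fun p => Finset.card_inter_add_card_sdiff p t
  have hcover : P ⊆ (P.filter fun p => p ⊆ t) ∪ (P.filter fun p => (p \ t).card = 1) ∪
      (P.filter fun p => p ⊆ tᶜ) := by
    intro p hp
    simp only [Finset.mem_union, Finset.mem_filter, hp, true_and]
    have h1 := hsum p
    rw [(hP p hp).1] at h1
    have h2 : (p \ t).card = 0 ∨ (p \ t).card = 1 ∨ (p ∩ t).card = 0 := by omega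
    rcases h2 with h2 | h2 | h2
    · rw [Finset.card_eq_zero, Finset.sdiff_eq_empty_iff_subset] at h2
      exact Or.inl (Or.inl h2)
    · exact Or.inl (Or.inr h2)
    · rw [Finset.card_eq_zero, ← Finset.disjoint_iff_inter_eq_empty] at h2
      exact Or.inr (Finset.subset_compl_iff_disjoint_right.2 h2)
  have hA : (P.filter fun p => p ⊆ t).card ≤ 3 := by
    refine (Finset.card_le_card (t := Finset.powersetCard 2 t) fun p hp => ?_).trans ?_
    · rw [Finset.mem_filter] at hp
      exact Finset.mem_powersetCard.2 ⟨hp.2, (hP p hp.1).1⟩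
    · rw [Finset.card_powersetCard, ht3]; decide
  have hB : (P.filter fun p => (p \ t).card = 1).card ≤ 3 := by
    have : (P.filter fun p => (p \ t).card = 1).card ≤ (Finset.powersetCard 1 tᶜ).card := by
      refine Finset.card_le_card_of_injOn (fun p => p \ t) (fun p hp => ?_) ?_
      · rw [Finset.mem_coe, Finset.mem_filter] at hp
        rw [Finset.mem_coe, Finset.mem_powersetCard]
        exact ⟨Finset.subset_compl_iff_disjoint_right.2 Finset.sdiff_disjoint, hp.2⟩
      · intro p hp q hq hpq
        rw [Finset.mem_coe, Finset.mem_filter] at hp hq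
        dsimp only at hpq
        obtain ⟨x, hx⟩ := Finset.card_eq_one.1 hp.2
        have hp1 : (p ∩ t).card = 1 := by have := hsum p; rw [(hP p hp.1).1, hp.2] at this; omega
        have hq1 : (q ∩ t).card = 1 := by have := hsum q; rw [(hP q hq.1).1, hq.2] at this; omega
        obtain ⟨y, hy⟩ := Finset.card_eq_one.1 hp1
        obtain ⟨z, hz⟩ := Finset.card_eq_one.1 hq1
        have hpe : p = {x, y} := by
          rw [← Finset.sdiff_union_inter p t, hx, hy]; rfl
        have hqe : q = {x, z} := by
          rw [← Finset.sdiff_union_inter q t, ← hpq, hx, hz]; rfl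
        have hxt : x ∉ t := (Finset.mem_sdiff.1 (hx ▸ Finset.mem_singleton_self x)).2
        have hyt : y ∈ t := (Finset.mem_inter.1 (hy ▸ Finset.mem_singleton_self y)).2
        have hzt : z ∈ t := (Finset.mem_inter.1 (hz ▸ Finset.mem_singleton_self z)).2
        -- Two pairs through `x` would give a second independent triple `x, y, z`.
        have hyz : y = z := by
          by_contra hyz
          have hxy : x ≠ y := fun e => hxt (e ▸ hyt)
          have hxz : x ≠ z := fun e => hxt (e ▸ hzt)
          refine hxt ((hmem {x, y, z} (Finset.card_eq_three.2 ⟨x, y, z, hxy, hxz, hyz, rfl⟩)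
            ?_) ▸ Finset.mem_insert_self x _)
          have hpi := (hP p hp.1).2
          have hqi := (hP q hq.1).2
          have n1 : ¬ G.Adj x y := hpi (by simp [hpe]) (by simp [hpe]) hxy
          have n2 : ¬ G.Adj x z := hqi (by simp [hqe]) (by simp [hqe]) hxz
          have n3 : ¬ G.Adj y z := htt.2.2 hyt hzt hyz
          intro a ha c hc hac
          simp only [Finset.coe_insert, Finset.coe_singleton, Set.mem_insert_iff,
            Set.mem_singleton_iff] at ha hc
          rcases ha with rfl | rfl | rfl <;> rcases hc with rfl | rfl | rfl <;>
            first
            | exact absurd rfl hac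
            | assumption
            | (rw [G.adj_comm]; assumption)
        rw [hpe, hqe, hyz]
    rwa [Finset.card_powersetCard, htc] at this
  have hC : (P.filter fun p => p ⊆ tᶜ).card ≤ 2 := by
    have hne : ¬ G.IsIndepSet ((tᶜ : Finset (Fin 6)) : Set (Fin 6)) := by
      intro hi
      have he := hmem tᶜ htc hi
      obtain ⟨x, hx⟩ := Finset.card_pos.1 (by omega : 0 < t.card)
      exact (Finset.mem_compl.1 (he.symm ▸ hx)) hx
    obtain ⟨i, j, hij, hsub⟩ := (not_isIndepSet_iff_exists_pair G _).1 hne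
    have : (P.filter fun p => p ⊆ tᶜ).card < (Finset.powersetCard 2 tᶜ).card := by
      refine Finset.card_lt_card ((Finset.ssubset_iff_of_subset fun p hp => ?_).2
        ⟨{i, j}, ?_, ?_⟩)
      · rw [Finset.mem_filter] at hp
        exact Finset.mem_powersetCard.2 ⟨hp.2, (hP p hp.1).1⟩
      · exact Finset.mem_powersetCard.2 ⟨hsub, Finset.card_pair hij.ne⟩
      · intro hp
        rw [Finset.mem_filter] at hp
        exact (not_isIndepSet_iff_exists_pair G _).2 ⟨i, j, hij, subset_rfl⟩ (hP _ hp.1).2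
    rw [Finset.card_powersetCard, htc] at this
    have h3 : Nat.choose 3 2 = 3 := by decide
    omega
  have := Finset.card_le_card hcover
  have h1 := Finset.card_union_le ((P.filter fun p => p ⊆ t) ∪
    (P.filter fun p => (p \ t).card = 1)) (P.filter fun p => p ⊆ tᶜ)
  have h2 := Finset.card_union_le (P.filter fun p => p ⊆ t)
    (P.filter fun p => (p \ t).card = 1)
  have h3 : indepCount G 2 = P.card := by
    unfold indepCount
    congr
  omega

theorem not_indepCount_eq {n : ℕ} (G : SimpleGraph (Fin n)) :
    ¬ (indepCount G 1 = 6 ∧ indepCount G 2 = 9 ∧ indepCount G 3 = 1) := by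
  rintro ⟨h1, h2, h3⟩
  rw [indepCount_one] at h1
  subst h1
  have := indepCount_two_le h3
  omega

/-! ### The contracting homotopy and regularity of the linear form -/

theorem contractLeft_monomial_eq_zero {K : Type*} [Field K] {n : ℕ} {v : Fin n}
    {S : Finset (Fin n)} (hv : v ∉ S) :
    CliffordAlgebra.contractLeft (Q := (0 : QuadraticForm K (Fin n → K)))
      (LinearMap.proj v : Module.Dual K (Fin n → K)) (stdMonomial K n S) = 0 := by
  induction S using Finset.induction_on with
  | empty =>
    have : stdMonomial K n ∅ = 1 := by
      rw [stdMonomial, ExteriorAlgebra.basis_apply_ofCard _ Finset.card_empty]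
      simp [ExteriorAlgebra.ιMulti_family, ExteriorAlgebra.ιMulti_apply]
    rw [this]
    exact CliffordAlgebra.contractLeft_one (Q := (0 : QuadraticForm K (Fin n → K))) _
  | insert i S hi ih =>
    rw [Finset.mem_insert, not_or] at hv
    obtain ⟨c, hc, hd⟩ := exists_monomial_mul (Pi.basisFun K (Fin n)) {i} S
    have hc0 : c ≠ 0 := hd.2 (by simpa using hi)
    have : stdMonomial K n (insert i S) = c⁻¹ • (extVar K i * stdMonomial K n S) := by
      rw [monomial_singleton, Pi.basisFun_apply, ← Finset.insert_eq] at hc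
      rw [hc, smul_smul, inv_mul_cancel₀ hc0, one_smul]
    rw [this, map_smul]
    -- `erw` sees through `ExteriorAlgebra.ι` being `CliffordAlgebra.ι` of the zero form.
    erw [CliffordAlgebra.contractLeft_ι_mul]
    rw [ih hv.2]
    simp [hv.1]

theorem exists_contractLeft_monomial {K : Type*} [Field K] {n : ℕ} {v : Fin n}
    {S : Finset (Fin n)} (hv : v ∈ S) : ∃ c : K,
    CliffordAlgebra.contractLeft (Q := (0 : QuadraticForm K (Fin n → K)))
      (LinearMap.proj v : Module.Dual K (Fin n → K)) (stdMonomial K n S) =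
      c • stdMonomial K n (S.erase v) := by
  obtain ⟨c, hc, hd⟩ := exists_monomial_mul (Pi.basisFun K (Fin n)) {v} (S.erase v)
  have hc0 : c ≠ 0 := hd.2 (by simp)
  refine ⟨c⁻¹, ?_⟩
  have : stdMonomial K n S = c⁻¹ • (extVar K v * stdMonomial K n (S.erase v)) := by
    rw [monomial_singleton, Pi.basisFun_apply, ← Finset.insert_eq, Finset.insert_erase hv] at hc
    rw [hc, smul_smul, inv_mul_cancel₀ hc0, one_smul]
  rw [this, map_smul]
  erw [CliffordAlgebra.contractLeft_ι_mul]
  rw [contractLeft_monomial_eq_zero (Finset.notMem_erase v S)]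
  simp

/-- One of the vertices `0`, `3`, `6` of the path. If `S` is independent, it has no neighbour
in `S`. -/
def freeVertex (S : Finset (Fin 7)) : Fin 7 :=
  if 1 ∉ S then 0 else if 5 ∉ S then 6 else 3

theorem freeVertex_union {i : Fin 7} (hi : i = 0 ∨ i = 3 ∨ i = 6) (S : Finset (Fin 7)) :
    freeVertex ({i} ∪ S) = freeVertex S := by
  rcases hi with rfl | rfl | rfl <;> simp [freeVertex]

theorem pathForm_freeVertex (K : Type*) [Field K] (S : Finset (Fin 7)) :
    pathForm K (freeVertex S) = 1 := by
  unfold freeVertex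
  split_ifs <;> simp [pathForm]

/-- Removing the free vertex of a dependent set leaves a dependent set: the edges at the free vertex
are absent, except if `1` and `5` are in `S`, and then `S` also contains the edge `12` or `45`. -/
theorem not_isIndepSet_erase_freeVertex {S : Finset (Fin 7)}
    (h : ¬ (SimpleGraph.pathGraph 7).IsIndepSet (S : Set (Fin 7))) :
    ¬ (SimpleGraph.pathGraph 7).IsIndepSet ((S.erase (freeVertex S) : Finset (Fin 7)) :
      Set (Fin 7)) := by
  have key : ∀ {T : Finset (Fin 7)} {i j : Fin 7}, i ∈ T → j ∈ T →
      (SimpleGraph.pathGraph 7).Adj i j →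
      ¬ (SimpleGraph.pathGraph 7).IsIndepSet (T : Set (Fin 7)) :=
    fun hi hj hij hT => hT hi hj hij.ne hij
  obtain ⟨i, j, hij, hsub⟩ := (not_isIndepSet_iff_exists_pair _ _).1 h
  have hi : i ∈ S := hsub (by simp)
  have hj : j ∈ S := hsub (by simp)
  clear h hsub
  wlog hlt : i.val + 1 = j.val generalizing i j
  · exact this j i hij.symm hj hi ((SimpleGraph.pathGraph_adj.1 hij).resolve_left hlt)
  have e12 : (SimpleGraph.pathGraph 7).Adj 1 2 := SimpleGraph.pathGraph_adj.2 (Or.inl rfl)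
  have e45 : (SimpleGraph.pathGraph 7).Adj 4 5 := SimpleGraph.pathGraph_adj.2 (Or.inl rfl)
  unfold freeVertex
  by_cases h1 : (1 : Fin 7) ∈ S
  · by_cases h5 : (5 : Fin 7) ∈ S
    · simp only [h1, h5, not_true_eq_false, if_false]
      by_cases hi3 : i = 3
      · have : j = 4 := by apply Fin.ext; rw [← hlt, hi3]; rfl
        exact key (Finset.mem_erase.2 ⟨by decide, this ▸ hj⟩)
          (Finset.mem_erase.2 ⟨by decide, h5⟩) e45
      · by_cases hj3 : j = 3
        · have : i = 2 := by apply Fin.ext; rw [hj3] at hlt; simpa using hlt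
          exact key (Finset.mem_erase.2 ⟨by decide, h1⟩)
            (Finset.mem_erase.2 ⟨by decide, this ▸ hi⟩) e12
        · exact key (Finset.mem_erase.2 ⟨hi3, hi⟩) (Finset.mem_erase.2 ⟨hj3, hj⟩) hij
    · simp only [h1, h5, not_true_eq_false, not_false_eq_true, if_true, if_false]
      have hj6 : j ≠ 6 := by
        rintro rfl
        have : i = 5 := by apply Fin.ext; simpa using hlt
        exact h5 (this ▸ hi)
      have hi6 : i ≠ 6 := by
        rintro rfl
        have := j.isLt
        rw [← hlt] at this
        simp at this
      exact key (Finset.mem_erase.2 ⟨hi6, hi⟩) (Finset.mem_erase.2 ⟨hj6, hj⟩) hij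
  · simp only [h1, not_false_eq_true, if_true]
    have hi0 : i ≠ 0 := by
      rintro rfl
      have : j = 1 := Fin.ext hlt.symm
      exact h1 (this ▸ hj)
    have hj0 : j ≠ 0 := by
      rintro rfl
      simp at hlt
    exact key (Finset.mem_erase.2 ⟨hi0, hi⟩) (Finset.mem_erase.2 ⟨hj0, hj⟩) hij

/-- The contracting homotopy for multiplication by `e_0 + e_3 + e_6`: on the monomial of `S` it is
the contraction against the coordinate of the free vertex of `S`. -/
noncomputable def pathHomotopy (K : Type*) [Field K] : ExtAlg K 7 →ₗ[K] ExtAlg K 7 :=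
  (stdMonomial K 7).constr K fun S =>
    CliffordAlgebra.contractLeft (Q := (0 : QuadraticForm K (Fin 7 → K)))
      (LinearMap.proj (freeVertex S) : Module.Dual K (Fin 7 → K)) (stdMonomial K 7 S)

theorem pathHomotopy_monomial (K : Type*) [Field K] (S : Finset (Fin 7)) :
    pathHomotopy K (stdMonomial K 7 S) =
      CliffordAlgebra.contractLeft (Q := (0 : QuadraticForm K (Fin 7 → K)))
        (LinearMap.proj (freeVertex S) : Module.Dual K (Fin 7 → K)) (stdMonomial K 7 S) :=
  Module.Basis.constr_basis _ _ _ _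

theorem pathHomotopy_extVar_mul (K : Type*) [Field K] {i : Fin 7} (hi : i = 0 ∨ i = 3 ∨ i = 6)
    (S : Finset (Fin 7)) :
    pathHomotopy K (extVar K i * stdMonomial K 7 S) =
      CliffordAlgebra.contractLeft (Q := (0 : QuadraticForm K (Fin 7 → K)))
        (LinearMap.proj (freeVertex S) : Module.Dual K (Fin 7 → K))
          (extVar K i * stdMonomial K 7 S) := by
  obtain ⟨c, hc, -⟩ := exists_monomial_mul (Pi.basisFun K (Fin 7)) {i} S
  rw [monomial_singleton, Pi.basisFun_apply] at hc
  rw [hc, map_smul, map_smul, pathHomotopy_monomial, freeVertex_union hi]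

/-- Multiplication by `e_0 + e_3 + e_6` does not change the free vertex, so that the Leibniz rule
for the contraction applies. -/
theorem pathHomotopy_add (K : Type*) [Field K] (x : ExtAlg K 7) :
    pathHomotopy K (ExteriorAlgebra.ι K (pathForm K) * x) +
      ExteriorAlgebra.ι K (pathForm K) * pathHomotopy K x = x := by
  have hx : x ∈ Submodule.span K (Set.range (stdMonomial K 7)) := by
    rw [(stdMonomial K 7).span_eq]; trivial
  induction hx using Submodule.span_induction with
  | mem x h =>
    obtain ⟨S, rfl⟩ := h
    have h1 : pathHomotopy K (ExteriorAlgebra.ι K (pathForm K) * stdMonomial K 7 S) =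
        CliffordAlgebra.contractLeft (Q := (0 : QuadraticForm K (Fin 7 → K)))
          (LinearMap.proj (freeVertex S) : Module.Dual K (Fin 7 → K))
            (ExteriorAlgebra.ι K (pathForm K) * stdMonomial K 7 S) := by
      simp only [pathForm, map_add, add_mul]
      rw [pathHomotopy_extVar_mul K (by simp), pathHomotopy_extVar_mul K (by simp),
        pathHomotopy_extVar_mul K (by simp)]
    rw [h1, pathHomotopy_monomial]
    erw [CliffordAlgebra.contractLeft_ι_mul]
    rw [LinearMap.proj_apply, pathForm_freeVertex, one_smul]
    exact sub_add_cancel _ _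
  | zero => simp
  | add x y _ _ hx hy =>
    rw [mul_add, map_add, map_add, mul_add, add_add_add_comm, hx, hy]
  | smul c x _ hx =>
    rw [mul_smul_comm, map_smul, map_smul, mul_smul_comm, ← smul_add, hx]

theorem pathHomotopy_mem {K : Type*} [Field K] {x : ExtAlg K 7}
    (hx : x ∈ extEdgeIdeal K (SimpleGraph.pathGraph 7)) :
    pathHomotopy K x ∈ extEdgeIdeal K (SimpleGraph.pathGraph 7) := by
  rw [mem_extEdgeIdeal_iff] at hx
  rw [← sum_repr_smul_monomial (Pi.basisFun K (Fin 7)) x, map_sum]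
  refine sum_mem fun S _ => ?_
  rw [map_smul]
  by_cases h0 : (stdMonomial K 7).repr x S = 0
  · rw [h0, zero_smul]; exact TwoSidedIdeal.zero_mem _
  refine smul_mem_twoSidedIdeal _ _ ?_
  rw [pathHomotopy_monomial]
  by_cases hv : freeVertex S ∈ S
  · obtain ⟨c, hc⟩ := exists_contractLeft_monomial (K := K) hv
    rw [hc]
    refine smul_mem_twoSidedIdeal _ _ ((mem_extEdgeIdeal_iff _ _).2 fun u hu => ?_)
    rw [Module.Basis.repr_self] at hu
    rw [(Finsupp.single_apply_ne_zero.1 hu).1]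
    exact not_isIndepSet_erase_freeVertex (hx S h0)
  · rw [contractLeft_monomial_eq_zero hv]
    exact TwoSidedIdeal.zero_mem _

theorem pathHomotopy_mem_extDeg {K : Type*} [Field K] {x : ExtAlg K 7} {i : ℕ}
    (hx : x ∈ extDeg K 7 (i + 1)) : pathHomotopy K x ∈ extDeg K 7 i := by
  rw [mem_extDeg_iff (Pi.basisFun K (Fin 7))] at hx
  rw [← sum_repr_smul_monomial (Pi.basisFun K (Fin 7)) x, map_sum]
  refine Submodule.sum_mem _ fun S _ => ?_
  rw [map_smul]
  by_cases h0 : (stdMonomial K 7).repr x S = 0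
  · rw [h0, zero_smul]; exact Submodule.zero_mem _
  refine Submodule.smul_mem _ _ ?_
  rw [pathHomotopy_monomial]
  by_cases hv : freeVertex S ∈ S
  · obtain ⟨c, hc⟩ := exists_contractLeft_monomial (K := K) hv
    rw [hc]
    have : (S.erase (freeVertex S)).card = i := by
      rw [Finset.card_erase_of_mem hv, hx S h0, Nat.add_sub_cancel]
    exact Submodule.smul_mem _ _ (this ▸ monomial_mem_extDeg _ _)
  · rw [contractLeft_monomial_eq_zero hv]
    exact Submodule.zero_mem _

theorem pathHomotopy_eq_zero {K : Type*} [Field K] {x : ExtAlg K 7}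
    (hx : x ∈ extDeg K 7 0) : pathHomotopy K x = 0 := by
  rw [mem_extDeg_iff (Pi.basisFun K (Fin 7))] at hx
  rw [← sum_repr_smul_monomial (Pi.basisFun K (Fin 7)) x, map_sum]
  refine Finset.sum_eq_zero fun S _ => ?_
  rw [map_smul]
  by_cases h0 : (stdMonomial K 7).repr x S = 0
  · rw [h0, zero_smul]
  rw [pathHomotopy_monomial, contractLeft_monomial_eq_zero, smul_zero]
  rw [Finset.card_eq_zero.1 (hx S h0)]
  exact Finset.notMem_empty _

theorem sub_mul_pathHomotopy_mem {K : Type*} [Field K] {x : ExtAlg K 7}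
    (hx : ExteriorAlgebra.ι K (pathForm K) * x ∈ extEdgeIdeal K (SimpleGraph.pathGraph 7)) :
    x - ExteriorAlgebra.ι K (pathForm K) * pathHomotopy K x ∈
      extEdgeIdeal K (SimpleGraph.pathGraph 7) := by
  have := pathHomotopy_mem hx
  rwa [← eq_sub_iff_add_eq.2 (pathHomotopy_add K x)]

theorem isExtRegular_pathForm (K : Type*) [Field K] :
    IsExtRegular (pathForm K) (ExtQuot (extEdgeIdeal K (SimpleGraph.pathGraph 7))) := by
  ext m
  obtain ⟨x, rfl⟩ := Ideal.Quotient.mk_surjective m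
  have hs : ∀ y : ExtAlg K 7, ExteriorAlgebra.ι K (pathForm K) •
      (Ideal.Quotient.mk (extEdgeIdeal K (SimpleGraph.pathGraph 7)).asIdeal y) =
      Ideal.Quotient.mk (extEdgeIdeal K (SimpleGraph.pathGraph 7)).asIdeal
        (ExteriorAlgebra.ι K (pathForm K) * y) := fun y => rfl
  constructor
  · intro h
    rw [Set.mem_ofPred_eq, hs, Ideal.Quotient.eq_zero_iff_mem, TwoSidedIdeal.mem_asIdeal] at h
    refine ⟨Ideal.Quotient.mk _ (pathHomotopy K x), ?_⟩
    dsimp only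
    rw [hs, eq_comm, Ideal.Quotient.mk_eq_mk_iff_sub_mem, TwoSidedIdeal.mem_asIdeal]
    exact sub_mul_pathHomotopy_mem h
  · rintro ⟨m, hm⟩
    dsimp only at hm
    rw [Set.mem_ofPred_eq, ← hm, smul_smul, ExteriorAlgebra.ι_sq_zero, zero_smul]

/-! ### The ideal generated by the edge ideal and the linear form -/

theorem exists_ι_mul_eq_mul_ι {K : Type*} [Field K] {n : ℕ} (l : Fin n → K) (a : ExtAlg K n) :
    ∃ a' : ExtAlg K n, ExteriorAlgebra.ι K l * a = a' * ExteriorAlgebra.ι K l := by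
  induction a using ExteriorAlgebra.induction with
  | algebraMap r => exact ⟨_, (Algebra.commutes r _).symm⟩
  | ι m =>
    refine ⟨-ExteriorAlgebra.ι K m, ?_⟩
    rw [neg_mul]
    exact eq_neg_of_add_eq_zero_left (ExteriorAlgebra.ι_add_mul_swap l m)
  | mul a b ha hb =>
    obtain ⟨a', ha⟩ := ha
    obtain ⟨b', hb⟩ := hb
    exact ⟨a' * b', by rw [← mul_assoc, ha, mul_assoc, hb, mul_assoc]⟩
  | add a b ha hb =>
    obtain ⟨a', ha⟩ := ha
    obtain ⟨b', hb⟩ := hb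
    exact ⟨a' + b', by rw [mul_add, ha, hb, add_mul]⟩

/-- As `e_0 + e_3 + e_6` is regular modulo the edge ideal, adding it to the edge ideal gives the
annihilator of `e_0 + e_3 + e_6` modulo the edge ideal. -/
theorem mem_pathIdeal_iff {K : Type*} [Field K] (x : ExtAlg K 7) :
    x ∈ pathIdeal K ↔
      ExteriorAlgebra.ι K (pathForm K) * x ∈ extEdgeIdeal K (SimpleGraph.pathGraph 7) := by
  constructor
  · intro hx
    let M : TwoSidedIdeal (ExtAlg K 7) := TwoSidedIdeal.mk'
      {x | ExteriorAlgebra.ι K (pathForm K) * x ∈ extEdgeIdeal K (SimpleGraph.pathGraph 7)}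
      (by rw [Set.mem_ofPred_eq, mul_zero]; exact TwoSidedIdeal.zero_mem _)
      (fun {x y} hx hy => by
        rw [Set.mem_ofPred_eq, mul_add]; exact TwoSidedIdeal.add_mem _ hx hy)
      (fun {x} hx => by rw [Set.mem_ofPred_eq, mul_neg]; exact TwoSidedIdeal.neg_mem _ hx)
      (fun {a x} hx => by
        obtain ⟨a', ha⟩ := exists_ι_mul_eq_mul_ι (pathForm K) a
        rw [Set.mem_ofPred_eq, ← mul_assoc, ha, mul_assoc]
        exact TwoSidedIdeal.mul_mem_left _ _ _ hx)
      (fun {x a} hx => by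
        rw [Set.mem_ofPred_eq, ← mul_assoc]
        exact TwoSidedIdeal.mul_mem_right _ _ _ hx)
    have hM : pathIdeal K ≤ M := by
      refine sup_le (fun y hy => ?_) (TwoSidedIdeal.span_le.2 ?_)
      · rw [TwoSidedIdeal.mem_mk']
        exact TwoSidedIdeal.mul_mem_left _ _ _ hy
      · rw [Set.singleton_subset_iff, SetLike.mem_coe, TwoSidedIdeal.mem_mk', Set.mem_ofPred_eq,
          ExteriorAlgebra.ι_sq_zero]
        exact TwoSidedIdeal.zero_mem _
    have := hM hx
    rwa [TwoSidedIdeal.mem_mk'] at this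
  · intro hx
    rw [← sub_add_cancel x (ExteriorAlgebra.ι K (pathForm K) * pathHomotopy K x)]
    exact TwoSidedIdeal.add_mem _ (TwoSidedIdeal.mem_sup_left (sub_mul_pathHomotopy_mem hx))
      (TwoSidedIdeal.mem_sup_right (TwoSidedIdeal.mul_mem_right _ _ _
        (TwoSidedIdeal.subset_span rfl)))

/-! ### Hilbert series -/

theorem finrank_map_add_finrank_inf_ker {K V W : Type*} [Field K] [AddCommGroup V] [Module K V]
    [AddCommGroup W] [Module K W] [FiniteDimensional K V] (f : V →ₗ[K] W) (p : Submodule K V) :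
    Module.finrank K (p.map f) + Module.finrank K (p ⊓ LinearMap.ker f : Submodule K V) =
      Module.finrank K p := by
  rw [← LinearMap.finrank_range_add_finrank_ker (f.domRestrict p), LinearMap.range_domRestrict,
    LinearMap.ker_domRestrict, ← Submodule.map_comap_subtype]
  congr 1
  exact (Submodule.equivMapOfInjective p.subtype p.subtype_injective _).symm.finrank_eq

instance finiteDimensional_extAlg (K : Type*) [Field K] (n : ℕ) :
    FiniteDimensional K (ExtAlg K n) :=
  Module.Finite.of_basis (stdMonomial K n)

theorem finiteDimensional_extQuot {K : Type*} [Field K] {n : ℕ} (I : TwoSidedIdeal (ExtAlg K n)) :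
    FiniteDimensional K (ExtQuot I) :=
  Module.Finite.of_surjective (Ideal.Quotient.mkₐ K I.asIdeal).toLinearMap
    (Ideal.Quotient.mkₐ_surjective K _)

/-- Multiplication by `e_0 + e_3 + e_6` on the quotient by the edge ideal of the path. -/
noncomputable def pathMul (K : Type*) [Field K] :
    ExtQuot (extEdgeIdeal K (SimpleGraph.pathGraph 7)) →ₗ[K]
      ExtQuot (extEdgeIdeal K (SimpleGraph.pathGraph 7)) :=
  LinearMap.mulLeft K (Ideal.Quotient.mkₐ K _ (ExteriorAlgebra.ι K (pathForm K)))

theorem pathMul_mk (K : Type*) [Field K] (x : ExtAlg K 7) :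
    pathMul K (Ideal.Quotient.mkₐ K _ x) =
      Ideal.Quotient.mkₐ K _ (ExteriorAlgebra.ι K (pathForm K) * x) := by
  rw [pathMul, LinearMap.mulLeft_apply, ← map_mul]

theorem pathMul_mk_eq_zero_iff (K : Type*) [Field K] (x : ExtAlg K 7) :
    pathMul K (Ideal.Quotient.mkₐ K _ x) = 0 ↔ x ∈ pathIdeal K := by
  rw [pathMul_mk, mk_eq_zero_iff, mem_pathIdeal_iff]

/-- Multiplication by `e_0 + e_3 + e_6` identifies the quotient by `pathIdeal` with its image. -/
theorem finrank_quotDeg_pathIdeal (K : Type*) [Field K] (i : ℕ) :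
    Module.finrank K (quotDeg (pathIdeal K) i) = Module.finrank K
      ((quotDeg (extEdgeIdeal K (SimpleGraph.pathGraph 7)) i).map (pathMul K)) := by
  have h1 := finrank_map_add_finrank_inf_ker
    (Ideal.Quotient.mkₐ K (pathIdeal K).asIdeal).toLinearMap (extDeg K 7 i)
  have h2 := finrank_map_add_finrank_inf_ker (pathMul K ∘ₗ (Ideal.Quotient.mkₐ K
    (extEdgeIdeal K (SimpleGraph.pathGraph 7)).asIdeal).toLinearMap) (extDeg K 7 i)
  have hk : LinearMap.ker (Ideal.Quotient.mkₐ K (pathIdeal K).asIdeal).toLinearMap =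
      LinearMap.ker (pathMul K ∘ₗ (Ideal.Quotient.mkₐ K
        (extEdgeIdeal K (SimpleGraph.pathGraph 7)).asIdeal).toLinearMap) := by
    ext x
    rw [LinearMap.mem_ker, LinearMap.mem_ker, AlgHom.toLinearMap_apply, LinearMap.comp_apply,
      AlgHom.toLinearMap_apply, mk_eq_zero_iff, pathMul_mk_eq_zero_iff]
  rw [hk] at h1
  rw [Submodule.map_comp] at h2
  exact Nat.add_right_cancel (h1.trans h2.symm)

theorem quotDeg_succ_inf_ker_pathMul (K : Type*) [Field K] (i : ℕ) :
    quotDeg (extEdgeIdeal K (SimpleGraph.pathGraph 7)) (i + 1) ⊓ LinearMap.ker (pathMul K) =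
      (quotDeg (extEdgeIdeal K (SimpleGraph.pathGraph 7)) i).map (pathMul K) := by
  apply le_antisymm
  · rintro _ ⟨⟨x, hx, rfl⟩, hk⟩
    rw [SetLike.mem_coe, LinearMap.mem_ker, AlgHom.toLinearMap_apply, pathMul_mk,
      mk_eq_zero_iff] at hk
    refine ⟨_, ⟨pathHomotopy K x, pathHomotopy_mem_extDeg hx, rfl⟩, ?_⟩
    rw [AlgHom.toLinearMap_apply, AlgHom.toLinearMap_apply, pathMul_mk, eq_comm, ← sub_eq_zero,
      ← map_sub, mk_eq_zero_iff]
    exact sub_mul_pathHomotopy_mem hk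
  · rintro _ ⟨_, ⟨x, hx, rfl⟩, rfl⟩
    rw [AlgHom.toLinearMap_apply]
    refine ⟨?_, ?_⟩
    · rw [pathMul_mk]
      exact ⟨_, ι_mul_mem_extDeg _ hx, rfl⟩
    · rw [SetLike.mem_coe, LinearMap.mem_ker, pathMul_mk, pathMul_mk, ← mul_assoc,
        ExteriorAlgebra.ι_sq_zero, zero_mul, map_zero]

theorem quotDeg_zero_inf_ker_pathMul (K : Type*) [Field K] :
    quotDeg (extEdgeIdeal K (SimpleGraph.pathGraph 7)) 0 ⊓ LinearMap.ker (pathMul K) = ⊥ := by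
  rw [eq_bot_iff]
  rintro _ ⟨⟨x, hx, rfl⟩, hk⟩
  rw [SetLike.mem_coe, LinearMap.mem_ker, AlgHom.toLinearMap_apply, pathMul_mk,
    mk_eq_zero_iff] at hk
  have := sub_mul_pathHomotopy_mem hk
  rw [pathHomotopy_eq_zero hx, mul_zero, sub_zero] at this
  rw [Submodule.mem_bot, AlgHom.toLinearMap_apply, mk_eq_zero_iff]
  exact this

theorem finrank_quotDeg_pathIdeal_zero (K : Type*) [Field K] :
    Module.finrank K (quotDeg (pathIdeal K) 0) = indepCount (SimpleGraph.pathGraph 7) 0 := by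
  have := finiteDimensional_extQuot (extEdgeIdeal K (SimpleGraph.pathGraph 7))
  rw [finrank_quotDeg_pathIdeal, ← finrank_quotDeg_extEdgeIdeal K,
    ← finrank_map_add_finrank_inf_ker (pathMul K)
      (quotDeg (extEdgeIdeal K (SimpleGraph.pathGraph 7)) 0), quotDeg_zero_inf_ker_pathMul,
    finrank_bot, add_zero]

theorem finrank_quotDeg_pathIdeal_succ (K : Type*) [Field K] (i : ℕ) :
    Module.finrank K (quotDeg (pathIdeal K) (i + 1)) +
      Module.finrank K (quotDeg (pathIdeal K) i) =
        indepCount (SimpleGraph.pathGraph 7) (i + 1) := by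
  have := finiteDimensional_extQuot (extEdgeIdeal K (SimpleGraph.pathGraph 7))
  rw [finrank_quotDeg_pathIdeal, finrank_quotDeg_pathIdeal, ← finrank_quotDeg_extEdgeIdeal K,
    ← finrank_map_add_finrank_inf_ker (pathMul K)
      (quotDeg (extEdgeIdeal K (SimpleGraph.pathGraph 7)) (i + 1)), quotDeg_succ_inf_ker_pathMul]

theorem isIndepSet_pathGraph_iff (u : Finset (Fin 7)) :
    (SimpleGraph.pathGraph 7).IsIndepSet (u : Set (Fin 7)) ↔
      ∀ i ∈ u, ∀ j ∈ u, i.val + 1 ≠ j.val := by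
  constructor
  · intro h i hi j hj hij
    have hadj : (SimpleGraph.pathGraph 7).Adj i j := SimpleGraph.pathGraph_adj.2 (Or.inl hij)
    exact h hi hj hadj.ne hadj
  · intro h i hi j hj _ hadj
    rcases SimpleGraph.pathGraph_adj.1 hadj with e | e
    · exact h i hi j hj e
    · exact h j hj i hi e

theorem indepCount_pathGraph (i : ℕ) : indepCount (SimpleGraph.pathGraph 7) i =
    (Finset.univ.filter fun u : Finset (Fin 7) =>
      u.card = i ∧ ∀ i ∈ u, ∀ j ∈ u, i.val + 1 ≠ j.val).card := by
  rw [indepCount]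
  congr 1
  ext u
  simp only [Finset.mem_filter, isIndepSet_pathGraph_iff]

theorem indepCount_pathGraph_eq_zero {i : ℕ} (hi : 5 ≤ i) :
    indepCount (SimpleGraph.pathGraph 7) i = 0 := by
  have key : ∀ u : Finset (Fin 7), (∀ i ∈ u, ∀ j ∈ u, i.val + 1 ≠ j.val) → u.card ≤ 4 := by
    decide +kernel
  rw [indepCount_pathGraph, Finset.card_eq_zero, Finset.filter_eq_empty_iff]
  rintro u - ⟨h1, h2⟩
  have := key u h2
  omega

theorem hilbertSeries_eq_iff {K R : Type*} [Field K] [Ring R] [Algebra K R]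
    (𝒜 : ℕ → Submodule K R) :
    hilbertSeries 𝒜 = 1 + 6 * PowerSeries.X + 9 * PowerSeries.X ^ 2 + PowerSeries.X ^ 3 ↔
      Module.finrank K (𝒜 0) = 1 ∧ Module.finrank K (𝒜 1) = 6 ∧ Module.finrank K (𝒜 2) = 9 ∧
        Module.finrank K (𝒜 3) = 1 ∧ ∀ i, Module.finrank K (𝒜 (i + 4)) = 0 := by
  have h6 : (6 : ℤ⟦X⟧) = PowerSeries.C 6 := by simp
  have h9 : (9 : ℤ⟦X⟧) = PowerSeries.C 9 := by simp
  rw [PowerSeries.ext_iff]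
  simp only [hilbertSeries, PowerSeries.coeff_mk, h6, h9, map_add, PowerSeries.coeff_C_mul,
    PowerSeries.coeff_one, PowerSeries.coeff_X, PowerSeries.coeff_X_pow]
  constructor
  · intro h
    refine ⟨?_, ?_, ?_, ?_, fun i => ?_⟩
    · have := h 0; norm_num at this; exact_mod_cast this
    · have := h 1; norm_num at this; exact_mod_cast this
    · have := h 2; norm_num at this; exact_mod_cast this
    · have := h 3; norm_num at this; exact_mod_cast this
    · have := h (i + 4)
      rw [if_neg (by omega), if_neg (by omega), if_neg (by omega), if_neg (by omega)] at this
      simpa using this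
  · rintro ⟨h0, h1, h2, h3, h4⟩ n
    match n with
    | 0 => simp [h0]
    | 1 => simp [h1]
    | 2 => simp [h2]
    | 3 => simp [h3]
    | i + 4 =>
      rw [h4, if_neg (by omega), if_neg (by omega), if_neg (by omega), if_neg (by omega)]
      simp

theorem hilbertSeries_pathIdeal (K : Type*) [Field K] :
    hilbertSeries (quotDeg (pathIdeal K)) =
      1 + 6 * PowerSeries.X + 9 * PowerSeries.X ^ 2 + PowerSeries.X ^ 3 := by
  have c0 : indepCount (SimpleGraph.pathGraph 7) 0 = 1 := by
    rw [indepCount_pathGraph]; decide +kernel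
  have c1 : indepCount (SimpleGraph.pathGraph 7) 1 = 7 := indepCount_one _
  have c2 : indepCount (SimpleGraph.pathGraph 7) 2 = 15 := by
    rw [indepCount_pathGraph]; decide +kernel
  have c3 : indepCount (SimpleGraph.pathGraph 7) 3 = 10 := by
    rw [indepCount_pathGraph]; decide +kernel
  have c4 : indepCount (SimpleGraph.pathGraph 7) 4 = 1 := by
    rw [indepCount_pathGraph]; decide +kernel
  have h0 := finrank_quotDeg_pathIdeal_zero K
  have h1 : Module.finrank K (quotDeg (pathIdeal K) 1) +
      Module.finrank K (quotDeg (pathIdeal K) 0) = _ :=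
    finrank_quotDeg_pathIdeal_succ K 0
  have h2 : Module.finrank K (quotDeg (pathIdeal K) 2) +
      Module.finrank K (quotDeg (pathIdeal K) 1) = _ :=
    finrank_quotDeg_pathIdeal_succ K 1
  have h3 : Module.finrank K (quotDeg (pathIdeal K) 3) +
      Module.finrank K (quotDeg (pathIdeal K) 2) = _ :=
    finrank_quotDeg_pathIdeal_succ K 2
  have h4 : Module.finrank K (quotDeg (pathIdeal K) 4) +
      Module.finrank K (quotDeg (pathIdeal K) 3) = _ :=
    finrank_quotDeg_pathIdeal_succ K 3
  rw [c0] at h0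
  rw [zero_add, c1] at h1
  rw [show 1 + 1 = 2 from rfl, c2] at h2
  rw [show 2 + 1 = 3 from rfl, c3] at h3
  rw [show 3 + 1 = 4 from rfl, c4] at h4
  rw [hilbertSeries_eq_iff]
  refine ⟨by omega, by omega, by omega, by omega, fun i => ?_⟩
  cases i with
  | zero => rw [zero_add]; omega
  | succ i =>
    have := finrank_quotDeg_pathIdeal_succ K (i + 4)
    rw [indepCount_pathGraph_eq_zero (by omega)] at this
    rw [show i + 1 + 4 = i + 4 + 1 by omega]
    omega

/-! ### The G-quadratic and LG-quadratic properties -/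

theorem hilbertSeries_ne_of_indepCount {K R : Type*} [Field K] [Ring R] [Algebra K R] {n : ℕ}
    {G : SimpleGraph (Fin n)} {𝒜 : ℕ → Submodule K R}
    (h : ∀ i, Module.finrank K (𝒜 i) = indepCount G i) :
    hilbertSeries 𝒜 ≠ 1 + 6 * PowerSeries.X + 9 * PowerSeries.X ^ 2 + PowerSeries.X ^ 3 := by
  intro hH
  obtain ⟨-, h1, h2, h3, -⟩ := (hilbertSeries_eq_iff 𝒜).1 hH
  rw [h] at h1 h2 h3
  exact not_indepCount_eq G ⟨h1, h2, h3⟩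

theorem GradedIso.finrank_eq {K R S : Type*} [Field K] [Ring R] [Algebra K R] [Ring S]
    [Algebra K S] {𝒜 : ℕ → Submodule K R} {ℬ : ℕ → Submodule K S} (h : GradedIso 𝒜 ℬ) (i : ℕ) :
    Module.finrank K (𝒜 i) = Module.finrank K (ℬ i) := by
  obtain ⟨φ, hφ⟩ := h
  rw [← hφ i]
  exact (Submodule.equivMapOfInjective φ.toLinearMap φ.injective (𝒜 i)).finrank_eq

theorem GradedIso.refl {K R : Type*} [Field K] [Ring R] [Algebra K R] (𝒜 : ℕ → Submodule K R) :
    GradedIso 𝒜 𝒜 :=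
  ⟨AlgEquiv.refl, fun i => by ext; simp⟩

theorem gradedIso_quotDeg_of_eq {K : Type*} [Field K] {n : ℕ} {I J : TwoSidedIdeal (ExtAlg K n)}
    (h : I = J) : GradedIso (quotDeg I) (quotDeg J) := by
  subst h
  exact GradedIso.refl _

/-- A quadratic Gröbner basis would give a graph with independence numbers `1, 6, 9, 1`. Linear
forms cannot occur in the defining ideal, since all leading monomials have degree at least two. -/
theorem not_isGQuadratic_pathIdeal (K : Type*) [Field K] :
    ¬ IsGQuadratic (quotDeg (pathIdeal K)) := by
  rintro ⟨n, J, hJ, hGB, hiso⟩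
  obtain ⟨G, hG⟩ := hGB.exists_graph hJ
  exact hilbertSeries_ne_of_indepCount (fun i => (hiso.finrank_eq i).trans (hG i))
    (hilbertSeries_pathIdeal K)

theorem IsExtRegular.congr {K : Type*} [Field K] {n : ℕ} {l : Fin n → K}
    {M N : Type*} [AddCommGroup M] [Module (ExtAlg K n) M] [AddCommGroup N]
    [Module (ExtAlg K n) N] (e : M ≃ₗ[ExtAlg K n] N) (h : IsExtRegular l M) :
    IsExtRegular l N := by
  have h' : ∀ m : M, ExteriorAlgebra.ι K l • m = 0 ↔ ∃ y : M, ExteriorAlgebra.ι K l • y = m :=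
    fun m => Set.ext_iff.1 h m
  ext m
  change ExteriorAlgebra.ι K l • m = 0 ↔ ∃ y : N, ExteriorAlgebra.ι K l • y = m
  rw [← e.symm.map_eq_zero_iff, map_smul, h']
  constructor
  · rintro ⟨y, hy⟩
    exact ⟨e y, by rw [← map_smul, hy, e.apply_symm_apply]⟩
  · rintro ⟨y, rfl⟩
    exact ⟨e.symm y, by rw [map_smul]⟩

theorem isExtRegularSequence_singleton {K : Type*} [Field K] {n : ℕ} {l : Fin n → K}
    {M : Type*} [AddCommGroup M] [Module (ExtAlg K n) M] (h : IsExtRegular l M) :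
    IsExtRegularSequence (fun _ : Fin 1 => l) M := by
  intro i
  refine h.congr (Submodule.quotEquivOfEqBot _ ?_).symm
  rw [Submodule.span_eq_bot]
  -- No index of `Fin 1` precedes `i`, so the submodule divided out is zero.
  rintro x ⟨j, hj, -⟩
  exact absurd hj (by rw [Subsingleton.elim j i]; exact lt_irrefl i)

theorem isLGQuadratic_pathIdeal (K : Type*) [Field K] :
    IsLGQuadratic (quotDeg (pathIdeal K)) := by
  refine ⟨7, extEdgeIdeal K (SimpleGraph.pathGraph 7), 1, fun _ => pathForm K,
    isGradedIdeal_extEdgeIdeal K _,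
    ⟨7, _, isGradedIdeal_extEdgeIdeal K _, hasQuadraticGroebnerBasis_extEdgeIdeal K _,
      GradedIso.refl _⟩,
    isExtRegularSequence_singleton (isExtRegular_pathForm K), gradedIso_quotDeg_of_eq ?_⟩
  unfold linearIdeal
  rw [Set.range_const]
  rfl

theorem mainTheorem2 (K : Type*) [Field K] :
    IsExtRegular (pathForm K) (ExtQuot (extEdgeIdeal K (SimpleGraph.pathGraph 7))) ∧
      IsLGQuadratic (quotDeg (pathIdeal K)) ∧
      ¬ IsGQuadratic (quotDeg (pathIdeal K)) ∧
      hilbertSeries (quotDeg (pathIdeal K)) =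
        1 + 6 * PowerSeries.X + 9 * PowerSeries.X ^ 2 + PowerSeries.X ^ 3 ∧
      ∀ (n : ℕ) (G : SimpleGraph (Fin n)),
        hilbertSeries (quotDeg (extEdgeIdeal K G)) ≠
          1 + 6 * PowerSeries.X + 9 * PowerSeries.X ^ 2 + PowerSeries.X ^ 3 :=
  ⟨isExtRegular_pathForm K, isLGQuadratic_pathIdeal K, not_isGQuadratic_pathIdeal K,
    hilbertSeries_pathIdeal K,
    fun _ G => hilbertSeries_ne_of_indepCount (finrank_quotDeg_extEdgeIdeal K G)⟩
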